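/- Consider semi-restricted Rock, Paper, Scissors over $3n$ rounds: the choices are numbered $1,2,3$ and $i+1$ beats $i \pmod 3$; in each round the two players choose simultaneously; the restricted player R must use each choice exactly $n$ times in total, while the normal player N is unrestricted. Suppose that both players play greedily: in each round, given the set of choices still available to R, each player uses, independently of the past and of the other player, an optimal (minimax) mixed strategy for the expected score of that single round, as if it were the last. Let $S^{\mathrm{gr}}_n$ be the final score of N, i.e. the number of rounds won by N minus the number of rounds lost by N. Let $$S^* := W+\max\{V_1+2V_2,\;V_2+2V_3,\;V_3+2V_1\},$$ where $W\sim N(0,2)$ is independent of the centred Gaussian vector $(V_1,V_2,V_3)$, with $\operatorname{Var}V_i=\tfrac23$ and $\operatorname{Cov}(V_i,V_j)=-\tfrac13$ for $i\ne j$. Then $S^*$ is the limit in distribution of $n^{-1/2}S^{\mathrm{gr}}_n$ as $n\to\infty$, it is square integrable, $$\mathbb E\,(S^*)^2 = 4+\frac{3\sqrt3}{2\pi}\doteq 4.82699,\qquad \operatorname{Var}S^* = 4-\frac{27-6\sqrt3}{4\pi}\doteq 2.67840,$$ and, as $n\to\infty$, $$\operatorname{Var} S^{\mathrm{gr}}_n\sim\Bigl(4-\frac{27-6\sqrt3}{4\pi}\Bigr)n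 .$$ (Numerical values are correct to within $5\cdot10^{-6}$.) -/

import Mathlib

open MeasureTheory ProbabilityTheory Filter
open scoped Real Asymptotics

namespace SemiRestrictedRPS

/-- The three choices Rock, Paper, Scissors, numbered cyclically: `i + 1` beats `i`. -/
abbrev Move : Type := Fin 3

/-- Score of the normal player N in one round, when the restricted player R plays `r`
and N plays `m`: `1` if N wins, `-1` if R wins, `0` for a draw. -/
def gain (r m : Move) : ℤ :=
  if m = r + 1 then 1 else if r = m + 1 then -1 else 0

/-- Expected score of N in one round, when R plays the mixed strategy `p` and N plays,
independently, the mixed strategy `q`. -/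
noncomputable def expGain (p q : PMF Move) : ℝ :=
  ∑ r : Move, ∑ m : Move, (p r).toReal * (q m).toReal * (gain r m : ℝ)

/-- Mixed strategies that use only moves in `A`. -/
abbrev MixedOn (A : Finset Move) : Type := {p : PMF Move // p.support ⊆ (A : Set Move)}

/-- `p` is an optimal strategy for R in the single round where R may use only the moves in `A`
and N is unrestricted: it is allowed, and it minimizes the maximum of the expected score of N
over all strategies of N. -/
def IsOptimalR (A : Finset Move) (p : PMF Move) : Prop :=
  p.support ⊆ (A : Set Move) ∧
    ∀ p' : MixedOn A, (⨆ q : PMF Move, expGain p q) ≤ ⨆ q : PMF Move, expGain p'.1 q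

/-- `q` is an optimal strategy for N in the single round where R may use only the moves in `A`
and N is unrestricted: it maximizes the minimum of the expected score of N over all
allowed strategies of R. -/
def IsOptimalN (A : Finset Move) (q : PMF Move) : Prop :=
  ∀ q' : PMF Move, (⨅ p : MixedOn A, expGain p.1 q') ≤ ⨅ p : MixedOn A, expGain p.1 q

/-- The greedy strategy of R: as if each round were the last, use an optimal strategy of the
single round, given the set `A` of choices that R still has available. -/
def IsGreedyR (ρ : Finset Move → PMF Move) : Prop :=
  ∀ A : Finset Move, A.Nonempty → IsOptimalR A (ρ A)

/-- The greedy strategy of N: as if each round were the last, use an optimal strategy of the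
single round, given the set `A` of choices that R still has available. -/
def IsGreedyN (ν : Finset Move → PMF Move) : Prop :=
  ∀ A : Finset Move, A.Nonempty → IsOptimalN A (ν A)

/-- The choices still available to R in the game over `3n` rounds, if `N i` is the number
of times that R has played `i` so far. -/
def avail (n : ℕ) (N : Move → ℕ) : Finset Move :=
  Finset.univ.filter fun i => N i < n

/-- One round. The state is the pair of the vector counting the moves of R so far and the score
of N so far. Given the state, the two players move independently. -/
noncomputable def playRound (ρ ν : Finset Move → PMF Move) (n : ℕ) (x : (Move → ℕ) × ℤ) :
    PMF ((Move → ℕ) × ℤ) :=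
  (ρ (avail n x.1)).bind fun r =>
    (ν (avail n x.1)).bind fun m =>
      PMF.pure (x.1 + Pi.single r 1, x.2 + gain r m)

/-- The joint law, after round `t`, of the counts of the moves of R and the score of N. -/
noncomputable def stateLaw (ρ ν : Finset Move → PMF Move) (n : ℕ) :
    ℕ → PMF ((Move → ℕ) × ℤ)
  | 0 => PMF.pure (0, 0)
  | t + 1 => (stateLaw ρ ν n t).bind (playRound ρ ν n)

/-- The law of the final score `S_n` of N, after all `3n` rounds. -/
noncomputable def scoreLaw (ρ ν : Finset Move → PMF Move) (n : ℕ) : PMF ℤ :=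
  (stateLaw ρ ν n (3 * n)).map Prod.snd

/-- The covariance matrix of `(V₁, V₂, V₃)`. -/
noncomputable def covV : Matrix (Fin 3) (Fin 3) ℝ :=
  !![2 / 3, -1 / 3, -1 / 3; -1 / 3, 2 / 3, -1 / 3; -1 / 3, -1 / 3, 2 / 3]

/-- The joint law of `(W, V)`, where `W ∼ N(0, 2)` and `V ∼ N(0, covV)` are independent. -/
noncomputable abbrev lawWV : Measure (ℝ × EuclideanSpace ℝ (Fin 3)) :=
  (gaussianReal 0 2).prod (multivariateGaussian 0 covV)

/-- The random variable `S* = W + max {V₁ + 2 V₂, V₂ + 2 V₃, V₃ + 2 V₁}`. -/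
noncomputable def Sstar (ω : ℝ × EuclideanSpace ℝ (Fin 3)) : ℝ :=
  ω.1 + max (ω.2 0 + 2 * ω.2 1) (max (ω.2 1 + 2 * ω.2 2) (ω.2 2 + 2 * ω.2 0))

end SemiRestrictedRPS

namespace SemiRestrictedRPS

/-! ### Sums over the three moves, relative to a given move -/

/-! The one-round optimal strategies are unique and explicit for each possible set of available
choices. While all three choices are available, both players are uniform, so the greedy game
coincides with a free game in which both play uniformly for all `3n` rounds.

Suppose choice `k` is exhausted, the score is `s`, and `a`, `b` copies of `k + 1`, `k + 2` remain.
Then `s + b/2` and `2a - b` are martingales until `a` or `b` vanishes, after which N wins every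
round. Hence the final score is `s + b/2 + |2a - b|/2` up to a mean-square error of order `a + b`.
This quantity equals `s + maxDiff` of the current counts, and continuing the free game to its end
moves `s + maxDiff` by no more than the same order. Typically `a + b` is of order `√n`, so the
greedy score is within order `n^(1/4)` of `freeScore` at the end of the free game. The comparison
(`norm_gStep_sub_uStep_le`) needs no coupling or stopping time: it is a backward induction on
iterated one-step expectations, with a bound that is itself a martingale of the free game.

In the free game the gain is uniform on `{0, 1, -1}` whatever R plays, so score and counts are
independent (`uStep_iterate_mul`). The central limit theorem (`tendsto_avg_exp_pow`) turns the score
into `W` and `maxDiff` into `topV` of `V`. A fourth-moment bound gives convergence of the first two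
moments, and the moments of `topV` are computed in polar coordinates on the plane carrying `V`
(`integral_topV_pow`). -/

lemma move_cases (k i : Move) : i = k ∨ i = k + 1 ∨ i = k + 2 := by
  revert k i; decide

lemma move_ne (k : Move) : k + 1 ≠ k ∧ k + 2 ≠ k ∧ k + 1 ≠ k + 2 ∧ k + 2 + 1 = k ∧
    k + 1 + 1 = k + 2 ∧ k + 2 + 2 = k + 1 ∧ k + 1 + 2 = k := by
  revert k; decide

/-- Expanding around an arbitrary base move lets one computation serve all three positions of the
exhausted choice. -/
lemma sum_move {M : Type*} [AddCommMonoid M] (k : Move) (f : Move → M) :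
    ∑ i, f i = f k + f (k + 1) + f (k + 2) := by
  have h : (Finset.univ : Finset Move) = {k, k + 1, k + 2} := by revert k; decide
  have := move_ne k
  rw [h, Finset.sum_insert (by simp [this.1.symm, this.2.1.symm]),
    Finset.sum_insert (by simp [this.2.2.1]), Finset.sum_singleton, add_assoc]

lemma gain_table (k : Move) : gain k k = 0 ∧ gain k (k + 1) = 1 ∧ gain k (k + 2) = -1 := by
  revert k; decide

lemma gain_table_one (k : Move) :
    gain (k + 1) k = -1 ∧ gain (k + 1) (k + 1) = 0 ∧ gain (k + 1) (k + 2) = 1 := by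
  revert k; decide

lemma gain_table_two (k : Move) :
    gain (k + 2) k = 1 ∧ gain (k + 2) (k + 1) = -1 ∧ gain (k + 2) (k + 2) = 0 := by
  revert k; decide

/-! ### Optimal strategies of a single round -/

/-- The weight of a mixed strategy as a real number. -/
noncomputable def wt (p : PMF Move) (i : Move) : ℝ := (p i).toReal

lemma wt_nonneg (p : PMF Move) (i : Move) : 0 ≤ wt p i := ENNReal.toReal_nonneg

lemma sum_wt (p : PMF Move) : ∑ i, wt p i = 1 := by
  unfold wt
  rw [← ENNReal.toReal_sum (fun i _ => p.apply_ne_top i), ← tsum_fintype (L := .unconditional _),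
    p.tsum_coe, ENNReal.toReal_one]

lemma wt_pure (i j : Move) : wt (PMF.pure i) j = if j = i then 1 else 0 := by
  unfold wt
  by_cases h : j = i <;> simp [PMF.pure_apply, h]

/-- The mixed strategy with prescribed weights. -/
noncomputable def ofWt (f : Move → ℝ) (h0 : ∀ i, 0 ≤ f i) (h1 : ∑ i, f i = 1) : PMF Move :=
  PMF.ofFintype (fun i => ENNReal.ofReal (f i)) (by
    rw [← ENNReal.ofReal_sum_of_nonneg fun i _ => h0 i, h1, ENNReal.ofReal_one])

lemma wt_ofWt (f : Move → ℝ) (h0 : ∀ i, 0 ≤ f i) (h1 : ∑ i, f i = 1) (i : Move) :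
    wt (ofWt f h0 h1) i = f i := by
  simp [wt, ofWt, ENNReal.toReal_ofReal (h0 i)]

lemma support_subset_iff (p : PMF Move) (A : Finset Move) :
    p.support ⊆ (A : Set Move) ↔ ∀ i ∉ A, wt p i = 0 := by
  constructor
  · intro h i hi
    have : p i = 0 := by
      by_contra h0
      exact hi (h ((PMF.mem_support_iff p i).2 h0))
    simp [wt, this]
  · intro h i hi
    by_contra h0
    have := h i h0
    unfold wt at this
    rw [ENNReal.toReal_eq_zero_iff] at this
    rcases this with h1 | h1
    · exact (PMF.mem_support_iff p i).1 hi h1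
    · exact p.apply_ne_top i h1

lemma expGain_eq (k : Move) (p q : PMF Move) : expGain p q =
    wt p k * (wt q (k + 1) - wt q (k + 2)) + wt p (k + 1) * (wt q (k + 2) - wt q k) +
      wt p (k + 2) * (wt q k - wt q (k + 1)) := by
  unfold expGain
  change ∑ r, ∑ m, wt p r * wt q m * (gain r m : ℝ) = _
  have h0 := gain_table k
  have h1 := gain_table_one k
  have h2 := gain_table_two k
  simp only [sum_move k, h0, h1, h2]
  push_cast
  ring

lemma wt_le_one (p : PMF Move) (i : Move) : wt p i ≤ 1 := by
  rw [← sum_wt p]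
  exact Finset.single_le_sum (fun j _ => wt_nonneg p j) (Finset.mem_univ i)

lemma abs_expGain_le (p q : PMF Move) : |expGain p q| ≤ 3 := by
  have h (i) := And.intro (wt_nonneg p i) (wt_le_one p i)
  have h' (i) := And.intro (wt_nonneg q i) (wt_le_one q i)
  have key : ∀ i j l, |wt p i * (wt q j - wt q l)| ≤ 1 := by
    intro i j l
    rw [abs_mul, abs_of_nonneg (h i).1]
    refine mul_le_one₀ (h i).2 (abs_nonneg _) (abs_le.2 ⟨?_, ?_⟩) <;>
      linarith [(h' j).1, (h' j).2, (h' l).1, (h' l).2]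
  rw [expGain_eq 0]
  refine (abs_add_three _ _ _).trans ?_
  linarith [key 0 (0 + 1) (0 + 2), key (0 + 1) (0 + 2) 0, key (0 + 2) 0 (0 + 1)]

/-- The only form in which minimax optimality is used: one test strategy with guarantee `v` bounds
the optimal one against every reply. Pure replies then pin down the weights. -/
lemma IsOptimalR.expGain_le {A : Finset Move} {p : PMF Move} (hp : IsOptimalR A p)
    {p' : PMF Move} (hp' : p'.support ⊆ (A : Set Move)) {v : ℝ} (hv : ∀ q, expGain p' q ≤ v)
    (q : PMF Move) : expGain p q ≤ v := by
  have : Nonempty (PMF Move) := ⟨PMF.pure 0⟩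
  -- Boundedness makes `⨆` a genuine supremum rather than the default value `0`.
  have hb : BddAbove (Set.range fun q => expGain p q) :=
    ⟨3, by rintro _ ⟨q, rfl⟩; exact (abs_le.1 (abs_expGain_le p q)).2⟩
  exact (le_ciSup hb q).trans ((hp.2 ⟨p', hp'⟩).trans (ciSup_le hv))

lemma IsOptimalN.le_expGain {A : Finset Move} {q : PMF Move} (hq : IsOptimalN A q)
    {q' : PMF Move} {v : ℝ} (hv : ∀ p : PMF Move, p.support ⊆ (A : Set Move) → v ≤ expGain p q')
    {p : PMF Move} (hp : p.support ⊆ (A : Set Move)) : v ≤ expGain p q := by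
  have : Nonempty (MixedOn A) := ⟨⟨p, hp⟩⟩
  have hb : BddBelow (Set.range fun p : MixedOn A => expGain p.1 q) :=
    ⟨-3, by rintro _ ⟨p, rfl⟩; exact (abs_le.1 (abs_expGain_le p.1 q)).1⟩
  exact (le_ciInf fun p : MixedOn A => hv p.1 p.2).trans ((hq q').trans (ciInf_le hb ⟨p, hp⟩))

lemma expGain_pure_right (k : Move) (p : PMF Move) :
    expGain p (PMF.pure k) = wt p (k + 2) - wt p (k + 1) := by
  have := move_ne k
  rw [expGain_eq k]
  simp [wt_pure, this.1, this.2.1]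
  ring

lemma expGain_pure_left (k : Move) (q : PMF Move) :
    expGain (PMF.pure k) q = wt q (k + 1) - wt q (k + 2) := by
  have := move_ne k
  rw [expGain_eq k]
  simp [wt_pure, this.1, this.2.1]

lemma pure_support_subset {A : Finset Move} {i : Move} (h : i ∈ A) :
    (PMF.pure i).support ⊆ (A : Set Move) := by
  rw [PMF.support_pure]
  simpa using h

/-- With all choices available, both optimal strategies are uniform. -/
lemma IsOptimalR.wt_univ {p : PMF Move} (hp : IsOptimalR Finset.univ p) (i : Move) :
    wt p i = 1 / 3 := by
  -- The uniform strategy guarantees `0`; the three pure replies then give a cyclic chain of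
  -- inequalities, forcing equal weights.
  have h := hp.expGain_le (p' := ofWt (fun _ => 1 / 3) (fun _ => by norm_num) (by simp))
    (by simp) (v := 0) (fun q => by
      rw [expGain_eq 0]; simp only [wt_ofWt]; linarith)
  have h0 := h (PMF.pure i)
  have h1 := h (PMF.pure (i + 1))
  have h2 := h (PMF.pure (i + 2))
  have hs := sum_wt p
  obtain ⟨_, _, _, e1, e2, e3, e4⟩ := move_ne i
  rw [sum_move i] at hs
  rw [expGain_pure_right] at h0 h1 h2
  rw [e2, e4] at h1
  rw [e1, e3] at h2
  linarith

lemma IsOptimalN.wt_univ {q : PMF Move} (hq : IsOptimalN Finset.univ q) (i : Move) :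
    wt q i = 1 / 3 := by
  have h (j : Move) := hq.le_expGain
    (q' := ofWt (fun _ => 1 / 3) (fun _ => by norm_num) (by simp)) (v := 0)
    (fun p _ => by rw [expGain_eq 0]; simp only [wt_ofWt]; linarith)
    (pure_support_subset (Finset.mem_univ j))
  have h0 := h i
  have h1 := h (i + 1)
  have h2 := h (i + 2)
  have hs := sum_wt q
  obtain ⟨_, _, _, e1, e2, e3, e4⟩ := move_ne i
  rw [sum_move i] at hs
  rw [expGain_pure_left] at h0 h1 h2
  rw [e2, e4] at h1
  rw [e1, e3] at h2
  linarith

/-- With only `k + 1` and `k + 2` available, R plays them with probabilities `1/3` and `2/3`. -/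
lemma IsOptimalR.wt_pair {k : Move} {p : PMF Move} (hp : IsOptimalR {k + 1, k + 2} p) :
    wt p k = 0 ∧ wt p (k + 1) = 1 / 3 ∧ wt p (k + 2) = 2 / 3 := by
  obtain ⟨n1, n2, n3, e1, e2, e3, e4⟩ := move_ne k
  have hk : wt p k = 0 := (support_subset_iff _ _).1 hp.1 k (by simp [n1.symm, n2.symm])
  -- These weights make the replies `k` and `k + 2` equally good, each worth `1/3`, the value of
  -- this round.
  let f : Move → ℝ := fun i => if i = k then 0 else if i = k + 1 then 1 / 3 else 2 / 3
  have f0 : f k = 0 := by simp [f]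
  have f1 : f (k + 1) = 1 / 3 := by simp [f]
  have f2 : f (k + 2) = 2 / 3 := by simp [f, n2]
  have h := hp.expGain_le (p' := ofWt f (fun i => by simp only [f]; split_ifs <;> norm_num)
    (by rw [sum_move k, f0, f1, f2]; norm_num))
    ((support_subset_iff _ _).2 fun i hi => by
      rw [wt_ofWt]
      rcases move_cases k i with rfl | rfl | rfl
      · exact f0
      · simp at hi
      · simp at hi) (v := 1 / 3) (fun q => by
      have hs := sum_wt q
      rw [sum_move k] at hs
      rw [expGain_eq k]
      simp only [wt_ofWt, f0, f1, f2]
      linarith [wt_nonneg q (k + 1)])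
  have h0 := h (PMF.pure k)
  have h2 := h (PMF.pure (k + 2))
  have hs := sum_wt p
  rw [sum_move k] at hs
  rw [expGain_pure_right] at h0 h2
  rw [e1, e3] at h2
  refine ⟨hk, ?_, ?_⟩ <;> linarith

/-- With only `k + 1` and `k + 2` available to R, N plays `k + 2` and `k` with probabilities
`2/3` and `1/3`. -/
lemma IsOptimalN.wt_pair {k : Move} {q : PMF Move} (hq : IsOptimalN {k + 1, k + 2} q) :
    wt q k = 1 / 3 ∧ wt q (k + 1) = 0 ∧ wt q (k + 2) = 2 / 3 := by
  obtain ⟨n1, n2, n3, e1, e2, e3, e4⟩ := move_ne k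
  let f : Move → ℝ := fun i => if i = k then 1 / 3 else if i = k + 1 then 0 else 2 / 3
  have f0 : f k = 1 / 3 := by simp [f]
  have f1 : f (k + 1) = 0 := by simp [f]
  have f2 : f (k + 2) = 2 / 3 := by simp [f, n2]
  have h {j : Move} (hj : j ∈ ({k + 1, k + 2} : Finset Move)) := hq.le_expGain
    (q' := ofWt f (fun i => by simp only [f]; split_ifs <;> norm_num)
    (by rw [sum_move k, f0, f1, f2]; norm_num)) (v := 1 / 3)
    (fun p hp => by
      have hs := sum_wt p
      rw [sum_move k, (support_subset_iff _ _).1 hp k (by simp [n1.symm, n2.symm])] at hs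
      rw [expGain_eq k, (support_subset_iff _ _).1 hp k (by simp [n1.symm, n2.symm])]
      simp only [wt_ofWt, f0, f1, f2]
      linarith)
    (pure_support_subset hj)
  have h1 := h (j := k + 1) (by simp)
  have h2 := h (j := k + 2) (by simp)
  have hs := sum_wt q
  rw [sum_move k] at hs
  rw [expGain_pure_left] at h1 h2
  rw [e2, e4] at h1
  rw [e1, e3] at h2
  -- With total mass one, the two inequalities leave `3 * wt q (k + 1) ≤ 0`, so everything is an
  -- equality.
  have := wt_nonneg q (k + 1)
  refine ⟨?_, ?_, ?_⟩ <;> linarith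

lemma IsOptimalR.wt_singleton {k : Move} {p : PMF Move} (hp : IsOptimalR {k} p) :
    wt p k = 1 ∧ wt p (k + 1) = 0 ∧ wt p (k + 2) = 0 := by
  obtain ⟨n1, n2, n3, e1, e2, e3, e4⟩ := move_ne k
  have h1 := (support_subset_iff _ _).1 hp.1 (k + 1) (by simp [n1])
  have h2 := (support_subset_iff _ _).1 hp.1 (k + 2) (by simp [n2])
  have hs := sum_wt p
  rw [sum_move k] at hs
  exact ⟨by linarith, h1, h2⟩

lemma IsOptimalN.wt_singleton {k : Move} {q : PMF Move} (hq : IsOptimalN {k} q) :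
    wt q k = 0 ∧ wt q (k + 1) = 1 ∧ wt q (k + 2) = 0 := by
  obtain ⟨n1, n2, n3, e1, e2, e3, e4⟩ := move_ne k
  have h := hq.le_expGain (q' := PMF.pure (k + 1)) (v := 1) (p := PMF.pure k)
    (fun p hp => by
      have h1 := (support_subset_iff _ _).1 hp (k + 1) (by simp [n1])
      have h2 := (support_subset_iff _ _).1 hp (k + 2) (by simp [n2])
      have hs := sum_wt p
      rw [sum_move k] at hs
      rw [expGain_pure_right, e2, e4]
      linarith)
    (pure_support_subset (by simp))
  rw [expGain_pure_left] at h
  have hs := sum_wt q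
  rw [sum_move k] at hs
  have := wt_nonneg q k
  have := wt_nonneg q (k + 2)
  refine ⟨?_, ?_, ?_⟩ <;> linarith

/-! ### One-step expectation operators -/

section operators

variable {E : Type*} [NormedAddCommGroup E] [NormedSpace ℝ E]

/-- Conditional expectation of `f` after one greedy round. -/
noncomputable def gStep (ρ ν : Finset Move → PMF Move) (n : ℕ) (f : (Move → ℕ) × ℤ → E)
    (x : (Move → ℕ) × ℤ) : E :=
  ∑ r, wt (ρ (avail n x.1)) r • ∑ m, wt (ν (avail n x.1)) m •
    f (x.1 + Pi.single r 1, x.2 + gain r m)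

/-- Conditional expectation of `f` after one round in which both players move uniformly. -/
noncomputable def uStep (f : (Move → ℕ) × ℤ → E) (x : (Move → ℕ) × ℤ) : E :=
  ∑ r : Move, (1 / 3 : ℝ) • ∑ m : Move, (1 / 3 : ℝ) •
    f (x.1 + Pi.single r 1, x.2 + gain r m)

/-- The bound is required only where the weight is nonzero, so that an exhausted choice, which R
plays with probability zero, needs no estimate. -/
lemma norm_avg_sub_le {ι : Type*} [Fintype ι] {w : ι → ℝ} (h0 : ∀ i, 0 ≤ w i)
    (h1 : ∑ i, w i = 1) {F : ι → E} {G : ι → ℝ} {v : E}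
    (h : ∀ i, w i ≠ 0 → ‖F i - v‖ ≤ G i) :
    ‖∑ i, w i • F i - v‖ ≤ ∑ i, w i * G i := by
  have : ∑ i, w i • F i - v = ∑ i, w i • (F i - v) := by
    simp only [smul_sub, Finset.sum_sub_distrib, ← Finset.sum_smul, h1, one_smul]
  rw [this]
  refine (norm_sum_le _ _).trans (Finset.sum_le_sum fun i _ => ?_)
  rw [norm_smul, Real.norm_of_nonneg (h0 i)]
  by_cases hi : w i = 0
  · simp [hi]
  · exact mul_le_mul_of_nonneg_left (h i hi) (h0 i)

lemma norm_gStep_sub_le (ρ ν : Finset Move → PMF Move) (n : ℕ) {f : (Move → ℕ) × ℤ → E}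
    {x : (Move → ℕ) × ℤ} {v : E} {G : Move → Move → ℝ}
    (h : ∀ r m, wt (ρ (avail n x.1)) r ≠ 0 →
      ‖f (x.1 + Pi.single r 1, x.2 + gain r m) - v‖ ≤ G r m) :
    ‖gStep ρ ν n f x - v‖ ≤
      ∑ r, wt (ρ (avail n x.1)) r * ∑ m, wt (ν (avail n x.1)) m * G r m :=
  norm_avg_sub_le (wt_nonneg _) (sum_wt _) fun r hr =>
    norm_avg_sub_le (wt_nonneg _) (sum_wt _) fun m _ => h r m hr

lemma norm_uStep_sub_le {f : (Move → ℕ) × ℤ → E}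
    {x : (Move → ℕ) × ℤ} {v : E} {G : Move → Move → ℝ}
    (h : ∀ r m, ‖f (x.1 + Pi.single r 1, x.2 + gain r m) - v‖ ≤ G r m) :
    ‖uStep f x - v‖ ≤ ∑ r, (1 / 3 : ℝ) * ∑ m, (1 / 3 : ℝ) * G r m :=
  norm_avg_sub_le (fun _ => by norm_num) (by simp) fun r _ =>
    norm_avg_sub_le (fun _ => by norm_num) (by simp) fun m _ => h r m

lemma uStep_sub (f g : (Move → ℕ) × ℤ → E) (x : (Move → ℕ) × ℤ) :
    uStep f x - uStep g x = uStep (f - g) x := by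
  simp only [uStep, Pi.sub_apply, smul_sub, Finset.sum_sub_distrib]

/-! ### The score law as an iterated expectation -/

lemma integral_bind_of_fintype {ι β : Type*} [Fintype ι] [MeasurableSpace β]
    (p : PMF ι) (g : ι → PMF β) {f : β → E} (hf : ∀ a, Integrable f (g a).toMeasure) :
    Integrable f (p.bind g).toMeasure ∧
      ∫ b, f b ∂(p.bind g).toMeasure = ∑ a, (p a).toReal • ∫ b, f b ∂(g a).toMeasure := by
  have h : (p.bind g).toMeasure = ∑ a, p a • (g a).toMeasure := by
    ext s hs
    rw [PMF.toMeasure_bind_apply _ _ _ hs, tsum_fintype, Measure.finsetSum_apply]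
    simp
  have hi (a : ι) : Integrable f (p a • (g a).toMeasure) := (hf a).smul_measure (p.apply_ne_top a)
  rw [h]
  refine ⟨integrable_finsetSum_measure.2 fun a _ => hi a, ?_⟩
  rw [integral_finsetSum_measure fun a _ => hi a]
  simp only [integral_smul_measure]

/-- The law of the final score when `t` rounds remain and the current state is `x`. -/
noncomputable def scoreFrom (ρ ν : Finset Move → PMF Move) (n : ℕ) :
    ℕ → (Move → ℕ) × ℤ → PMF ℤ
  | 0 => fun x => PMF.pure x.2
  | t + 1 => fun x => (ρ (avail n x.1)).bind fun r => (ν (avail n x.1)).bind fun m =>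
      scoreFrom ρ ν n t (x.1 + Pi.single r 1, x.2 + gain r m)

lemma scoreFrom_succ (ρ ν : Finset Move → PMF Move) (n t : ℕ) (x : (Move → ℕ) × ℤ) :
    scoreFrom ρ ν n (t + 1) x = (playRound ρ ν n x).bind (scoreFrom ρ ν n t) := by
  simp only [scoreFrom, playRound, PMF.bind_bind, PMF.pure_bind]

/-- Markov property: the forward recursion of the definition becomes a backward recursion, on which
all later inductions run. -/
lemma stateLaw_bind_scoreFrom (ρ ν : Finset Move → PMF Move) (n k t : ℕ) :
    (stateLaw ρ ν n t).bind (scoreFrom ρ ν n k) = (stateLaw ρ ν n (t + k)).map Prod.snd := by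
  induction k generalizing t with
  | zero => rfl
  | succ k ih =>
    have : scoreFrom ρ ν n (k + 1) =
        fun x => (playRound ρ ν n x).bind (scoreFrom ρ ν n k) :=
      funext fun x => scoreFrom_succ ρ ν n k x
    rw [this, ← PMF.bind_bind]
    have h := ih (t + 1)
    rw [show t + 1 + k = t + (k + 1) by ring] at h
    exact h

lemma scoreLaw_eq (ρ ν : Finset Move → PMF Move) (n : ℕ) :
    scoreLaw ρ ν n = scoreFrom ρ ν n (3 * n) (0, 0) := by
  have h := stateLaw_bind_scoreFrom ρ ν n (3 * n) 0
  rw [stateLaw, PMF.pure_bind, zero_add] at h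
  exact h.symm

/-- Every `f` is integrable because only finitely many outcomes have positive mass; integrability is
carried through the induction. -/
lemma integral_scoreFrom [CompleteSpace E] (ρ ν : Finset Move → PMF Move) (n t : ℕ) (f : ℤ → E)
    (x : (Move → ℕ) × ℤ) :
    Integrable f (scoreFrom ρ ν n t x).toMeasure ∧
      ∫ k, f k ∂(scoreFrom ρ ν n t x).toMeasure =
        (gStep ρ ν n)^[t] (fun x => f x.2) x := by
  induction t generalizing x with
  | zero =>
    have : (scoreFrom ρ ν n 0 x).toMeasure = Measure.dirac x.2 := PMF.toMeasure_pure _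
    rw [this]
    exact ⟨integrable_dirac (by simp), by simp⟩
  | succ t ih =>
    have h1 (r : Move) := integral_bind_of_fintype (ν (avail n x.1))
      (fun m => scoreFrom ρ ν n t (x.1 + Pi.single r 1, x.2 + gain r m)) (fun m => (ih _).1)
    have h2 := integral_bind_of_fintype (ρ (avail n x.1)) _ (fun r => (h1 r).1)
    refine ⟨h2.1, h2.2.trans ?_⟩
    rw [Function.iterate_succ_apply']
    refine Finset.sum_congr rfl fun r _ => ?_
    rw [(h1 r).2]
    refine congrArg _ (Finset.sum_congr rfl fun m _ => ?_)
    rw [(ih _).2]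
    rfl

lemma integral_scoreLaw [CompleteSpace E] (ρ ν : Finset Move → PMF Move) (n : ℕ) (f : ℤ → E) :
    Integrable f (scoreLaw ρ ν n).toMeasure ∧
      ∫ k, f k ∂(scoreLaw ρ ν n).toMeasure =
        (gStep ρ ν n)^[3 * n] (fun x => f x.2) (0, 0) := by
  rw [scoreLaw_eq]
  exact integral_scoreFrom ρ ν n (3 * n) f (0, 0)

/-! ### The three phases of the greedy game -/

lemma avail_univ {n : ℕ} {N : Move → ℕ} (h : ∀ i, N i < n) : avail n N = Finset.univ := by
  simp [avail, h]

lemma avail_pair {n : ℕ} {N : Move → ℕ} {k : Move} (h0 : n ≤ N k) (h1 : N (k + 1) < n)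
    (h2 : N (k + 2) < n) : avail n N = {k + 1, k + 2} := by
  obtain ⟨n1, n2, n3, e1, e2, e3, e4⟩ := move_ne k
  ext i
  rcases move_cases k i with rfl | rfl | rfl
  · simp [avail, h0]
  · simp [avail, h1]
  · simp [avail, h2]

lemma avail_singleton {n : ℕ} {N : Move → ℕ} {k : Move} (h0 : N k < n) (h1 : n ≤ N (k + 1))
    (h2 : n ≤ N (k + 2)) : avail n N = {k} := by
  obtain ⟨n1, n2, n3, e1, e2, e3, e4⟩ := move_ne k
  ext i
  rcases move_cases k i with rfl | rfl | rfl
  · simp [avail, h0]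
  · simp [avail, h1]
  · simp [avail, h2]

lemma gStep_univ {ρ ν : Finset Move → PMF Move} (hρ : IsGreedyR ρ) (hν : IsGreedyN ν) {n : ℕ}
    (f : (Move → ℕ) × ℤ → E) {x : (Move → ℕ) × ℤ} (h : ∀ i, x.1 i < n) :
    gStep ρ ν n f x = uStep f x := by
  unfold gStep uStep
  rw [avail_univ h]
  have h1 := (hρ Finset.univ Finset.univ_nonempty).wt_univ
  have h2 := (hν Finset.univ Finset.univ_nonempty).wt_univ
  simp only [h1, h2]

/-- When R has a single choice left, N wins all the remaining rounds. -/
lemma gStep_iterate_singleton {ρ ν : Finset Move → PMF Move} (hρ : IsGreedyR ρ)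
    (hν : IsGreedyN ν) {n : ℕ} (φ : ℝ → E) {k : Move} (t : ℕ) {N : Move → ℕ} (s : ℤ)
    (h0 : N k + t = n) (h1 : n ≤ N (k + 1)) (h2 : n ≤ N (k + 2)) :
    (gStep ρ ν n)^[t] (fun x => φ x.2) (N, s) = φ (s + t) := by
  obtain ⟨n1, n2, n3, e1, e2, e3, e4⟩ := move_ne k
  induction t generalizing N s with
  | zero => simp
  | succ t ih =>
    have hR := (hρ {k} (by simp)).wt_singleton
    have hN := (hν {k} (by simp)).wt_singleton
    rw [Function.iterate_succ_apply', gStep,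
      avail_singleton (show N k < n by omega) h1 h2]
    simp only [sum_move k, hR, hN, zero_smul, one_smul, add_zero, zero_add]
    rw [ih (N := N + Pi.single k 1) (s + gain k (k + 1)) (by simp; omega) (by simp [n1]; omega)
      (by simp [n2]; omega), (gain_table k).2.1]
    push_cast
    congr 1
    ring

/-- Here `x` stands for the deviation of `s + b/2` from `c`, and `d`, `e` for the current and the
reference value of `2a - b`. -/
lemma sq_sub_abs_le (x d e : ℝ) : (x + |d| / 2 - |e| / 2) ^ 2 ≤ 2 * x ^ 2 + (d - e) ^ 2 / 2 := by
  have h : (|d| - |e|) ^ 2 ≤ (d - e) ^ 2 := sq_le_sq.2 (abs_abs_sub_abs_le_abs_sub d e)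
  nlinarith [sq_nonneg (x - (|d| - |e|) / 2)]

/-- When choice `k` is used up and `a`, `b` are the remaining numbers of `k + 1`, `k + 2`,
the score plus `b / 2` and `2 * a - b` are martingales as long as both are positive. -/
lemma norm_gStep_iterate_sub_le {ρ ν : Finset Move → PMF Move} (hρ : IsGreedyR ρ)
    (hν : IsGreedyN ν) {n : ℕ} {φ : ℝ → E} {v : E} {c e a0 b0 : ℝ}
    (hφ : ∀ s, ‖φ s - v‖ ≤ a0 + b0 * (s - c - |e| / 2) ^ 2) (hb0 : 0 ≤ b0)
    {k : Move} (t a b : ℕ) (ht : a + b = t) {N : Move → ℕ} (s : ℤ)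
    (h0 : n ≤ N k) (h1 : N (k + 1) + a = n) (h2 : N (k + 2) + b = n) :
    ‖(gStep ρ ν n)^[t] (fun x => φ x.2) (N, s) - v‖ ≤
      a0 + b0 * (2 * (s + b / 2 - c) ^ 2 + (2 * a - b - e) ^ 2 / 2 + 2 * t) := by
  obtain ⟨n1, n2, n3, e1, e2, e3, e4⟩ := move_ne k
  induction t generalizing a b N s with
  | zero =>
    obtain ⟨rfl, rfl⟩ : a = 0 ∧ b = 0 := by omega
    refine (hφ _).trans ?_
    have := sq_sub_abs_le (s - c) 0 e
    simp only [abs_zero] at this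
    simp only [CharP.cast_eq_zero]
    gcongr
    linarith
  | succ t ih =>
    -- Once `a = 0`, N wins the `b` remaining rounds, and `s + b = (s + b/2) + |2a - b|/2`. The case
    -- `b = 0` is analogous, with final score `s + a`.
    rcases Nat.eq_zero_or_pos a with rfl | ha
    · have hb : b = t + 1 := by omega
      rw [gStep_iterate_singleton hρ hν φ (k := k + 2) (t + 1) s (by omega) (by rw [e1]; omega)
        (by rw [e3]; omega)]
      refine (hφ _).trans ?_
      have := sq_sub_abs_le (s + b / 2 - c) (-b) e
      rw [abs_neg, Nat.abs_cast] at this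
      rw [← hb]
      have hb' : (0 : ℝ) ≤ b := b.cast_nonneg
      gcongr
      simp only [CharP.cast_eq_zero]
      refine le_trans (le_of_eq ?_) (this.trans ?_)
      · ring
      · linarith
    rcases Nat.eq_zero_or_pos b with rfl | hb
    · have ha : a = t + 1 := by omega
      rw [gStep_iterate_singleton hρ hν φ (k := k + 1) (t + 1) s (by omega) (by rw [e2]; omega)
        (by rw [e4]; omega)]
      refine (hφ _).trans ?_
      have := sq_sub_abs_le (s - c) (2 * a) e
      rw [abs_mul, Nat.abs_cast, abs_two] at this
      rw [← ha]
      have ha' : (0 : ℝ) ≤ a := a.cast_nonneg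
      gcongr
      simp only [CharP.cast_eq_zero]
      refine le_trans (le_of_eq ?_) (this.trans ?_)
      · ring
      · linarith
    have hR := (hρ {k + 1, k + 2} (by simp)).wt_pair
    have hN := (hν {k + 1, k + 2} (by simp)).wt_pair
    rw [Function.iterate_succ_apply']
    have hav := avail_pair h0 (show N (k + 1) < n by omega) (show N (k + 2) < n by omega)
    let a' : Move → ℝ := fun r => if r = k + 1 then a - 1 else a
    let b' : Move → ℝ := fun r => if r = k + 1 then b else b - 1
    refine (norm_gStep_sub_le ρ ν n (G := fun r m => a0 + b0 *
      (2 * ((s + gain r m : ℤ) + b' r / 2 - c) ^ 2 + (2 * a' r - b' r - e) ^ 2 / 2 + 2 * t))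
      fun r m hr => ?_).trans ?_
    · rw [hav] at hr
      rcases move_cases k r with rfl | rfl | rfl
      · exact absurd hR.1 hr
      · have := ih (a - 1) b (by omega) (N := N + Pi.single (k + 1) 1) (s + gain (k + 1) m)
          (by simp [n1.symm]; omega) (by simp; omega) (by simp [n3.symm]; omega)
        rw [Nat.cast_pred ha] at this
        simpa only [a', b', if_true] using this
      · have := ih a (b - 1) (by omega) (N := N + Pi.single (k + 2) 1) (s + gain (k + 2) m)
          (by simp [n2.symm]; omega) (by simp [n3]; omega) (by simp; omega)
        rw [Nat.cast_pred hb] at this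
        simpa only [a', b', n3.symm, if_false] using this
    · rw [hav]
      simp only [sum_move k, hR, hN, gain_table_one k, gain_table_two k, a', b', if_true,
        n3.symm, if_false]
      push_cast
      -- Cross terms vanish by the martingale property. The increments of `s + b/2` and `2a - b`
      -- have variances `1/2` and `2`, and `2 * (1/2) + 2/2 = 2` is the coefficient of `t`.
      apply le_of_eq
      ring

end operators

/-! ### Comparison with the free game -/

/-- The largest cyclic difference of a vector. -/
noncomputable def maxDiff (x : Fin 3 → ℝ) : ℝ :=
  max (x 0 - x 1) (max (x 1 - x 2) (x 2 - x 0))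

/-- The sum of the squared cyclic differences of a vector. -/
def sqDiff (x : Fin 3 → ℝ) : ℝ := (x 0 - x 1) ^ 2 + (x 1 - x 2) ^ 2 + (x 2 - x 0) ^ 2

/-- The vector of the numbers of moves, as real numbers. -/
def realVec (N : Move → ℕ) : Fin 3 → ℝ := fun i => N i

lemma sqDiff_nonneg (x : Fin 3 → ℝ) : 0 ≤ sqDiff x := by unfold sqDiff; positivity

lemma maxDiff_eq (k : Move) (x : Fin 3 → ℝ) : maxDiff x =
    max (x k - x (k + 1)) (max (x (k + 1) - x (k + 2)) (x (k + 2) - x k)) := by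
  unfold maxDiff
  fin_cases k
  · rfl
  · change _ = max (x 1 - x 2) (max (x 2 - x 0) (x 0 - x 1))
    rw [← max_assoc (x 1 - x 2), max_comm]
  · change _ = max (x 2 - x 0) (max (x 0 - x 1) (x 1 - x 2))
    rw [← max_assoc, max_comm]

lemma sqDiff_eq (k : Move) (x : Fin 3 → ℝ) : sqDiff x =
    (x k - x (k + 1)) ^ 2 + (x (k + 1) - x (k + 2)) ^ 2 + (x (k + 2) - x k) ^ 2 := by
  unfold sqDiff
  fin_cases k
  · rfl
  · change _ = (x 1 - x 2) ^ 2 + (x 2 - x 0) ^ 2 + (x 0 - x 1) ^ 2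
    ring
  · change _ = (x 2 - x 0) ^ 2 + (x 0 - x 1) ^ 2 + (x 1 - x 2) ^ 2
    ring

lemma abs_maxDiff_sub_le (x y : Fin 3 → ℝ) : |maxDiff x - maxDiff y| ≤
    max |(x 0 - x 1) - (y 0 - y 1)|
      (max |(x 1 - x 2) - (y 1 - y 2)| |(x 2 - x 0) - (y 2 - y 0)|) :=
  (abs_max_sub_max_le_max _ _ _ _).trans
    (max_le_max le_rfl (abs_max_sub_max_le_max _ _ _ _))

lemma sq_maxDiff_sub_le (x y : Fin 3 → ℝ) : (maxDiff x - maxDiff y) ^ 2 ≤ sqDiff (x - y) := by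
  have h := abs_maxDiff_sub_le x y
  simp only [le_max_iff] at h
  unfold sqDiff
  simp only [Pi.sub_apply]
  rcases h with h | h | h <;> have := sq_le_sq.2 h <;>
    nlinarith [sq_nonneg ((x 0 - x 1) - (y 0 - y 1)), sq_nonneg ((x 1 - x 2) - (y 1 - y 2)),
      sq_nonneg ((x 2 - x 0) - (y 2 - y 0))]

lemma sq_maxDiff_le (x : Fin 3 → ℝ) : maxDiff x ^ 2 ≤ sqDiff x := by
  simpa [maxDiff] using sq_maxDiff_sub_le x 0

lemma realVec_add_single (N : Move → ℕ) (r : Move) :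
    realVec (N + Pi.single r 1) = realVec N + Pi.single r 1 := by
  ext i
  by_cases h : i = r
  · subst h; simp [realVec]
  · simp [realVec, h]

/-- Consequently `sqDiff + 2 * t`, with `t` rounds remaining, is a martingale of the free walk. -/
lemma sum_sqDiff_add_single (x : Fin 3 → ℝ) :
    ∑ r, sqDiff (x + Pi.single r 1) = 3 * sqDiff x + 6 := by
  simp [sum_move 0, sqDiff]
  ring

lemma sum_sq_add_gain (s : ℝ) (r : Move) :
    ∑ m, (s + gain r m) ^ 2 = 3 * s ^ 2 + 2 := by
  simp only [sum_move r, gain_table r]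
  push_cast
  ring

section compare

variable {E : Type*} [NormedAddCommGroup E] [NormedSpace ℝ E]

/-- The approximation of the final score used for the free game. -/
noncomputable def freeScore (x : (Move → ℕ) × ℤ) : ℝ := x.2 + maxDiff (realVec x.1)

/-- Mean-square stability of `freeScore`: each round contributes `2/3` from the score and `2` from
`sqDiff`, both doubled, which gives `16/3`. -/
lemma norm_uStep_iterate_sub_le {φ : ℝ → E} {v : E} {c a0 b0 : ℝ} {z : Fin 3 → ℝ}
    (hφ : ∀ s, ‖φ s - v‖ ≤ a0 + b0 * (s - (c + maxDiff z)) ^ 2) (hb0 : 0 ≤ b0)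
    (t : ℕ) (N : Move → ℕ) (s : ℤ) :
    ‖uStep^[t] (fun x => φ (freeScore x)) (N, s) - v‖ ≤
      a0 + b0 * (2 * (s - c) ^ 2 + 2 * sqDiff (realVec N - z) + 16 / 3 * t) := by
  induction t generalizing N s with
  | zero =>
    refine (hφ _).trans ?_
    have h1 := sq_maxDiff_sub_le (realVec N) z
    simp only [freeScore, CharP.cast_eq_zero, mul_zero, add_zero]
    gcongr
    nlinarith [sq_nonneg ((s - c) - (maxDiff (realVec N) - maxDiff z))]
  | succ t ih =>
    rw [Function.iterate_succ_apply']
    refine (norm_uStep_sub_le (G := fun r m => a0 + b0 * (2 * ((s - c) + gain r m) ^ 2 +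
      2 * sqDiff (realVec N - z + Pi.single r 1) + 16 / 3 * t)) fun r m => ?_).trans ?_
    · refine (ih (N + Pi.single r 1) (s + gain r m)).trans (le_of_eq ?_)
      rw [realVec_add_single]
      push_cast
      congr 4
      · ring
      · congr 2
        abel
    · have inner (r : Move) : ∑ m, (1 / 3 : ℝ) * (a0 + b0 * (2 * ((s - c) + gain r m) ^ 2 +
          2 * sqDiff (realVec N - z + Pi.single r 1) + 16 / 3 * t)) =
          a0 + b0 * (2 * (s - c) ^ 2 + 4 / 3 +
            2 * sqDiff (realVec N - z + Pi.single r 1) + 16 / 3 * t) := by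
        have := sum_sq_add_gain (s - c) r
        simp only [sum_move r] at this ⊢
        linear_combination (2 / 3 * b0) * this
      have outer := sum_sqDiff_add_single (realVec N - z)
      simp only [inner]
      simp only [Fin.sum_univ_three] at outer ⊢
      push_cast
      apply le_of_eq
      linear_combination (2 / 3 * b0) * outer

/-- When `k` is exhausted, the cyclic differences of the counts are `a`, `b - a`, `-b`; this
identity matches the greedy limit with `maxDiff`. -/
lemma max_eq_half_add_abs {a b : ℝ} (ha : 0 ≤ a) (hb : 0 ≤ b) :
    max a (max (b - a) (-b)) = b / 2 + |2 * a - b| / 2 := by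
  rw [← max_assoc, max_eq_left (show -b ≤ max a (b - a) from le_max_of_le_left (by linarith))]
  rcases le_total a (b - a) with h | h
  · rw [max_eq_right h, abs_of_nonpos (by linarith)]; ring
  · rw [max_eq_left h, abs_of_nonneg (by linarith)]; ring

/-- Both games are compared with `φ y`, where `y = s + maxDiff` at the current state; each error is
of order `β * t`. The terms `2/3 * t` and `2 * t` on the right are slack that makes the bound a
martingale for the phase before exhaustion. -/
lemma norm_gStep_sub_uStep_le_of_exhausted {ρ ν : Finset Move → PMF Move} (hρ : IsGreedyR ρ)
    (hν : IsGreedyN ν) {n : ℕ} {φ : ℝ → E} {α β γ δ : ℝ} (hβ : 0 ≤ β) (hγ : 0 ≤ γ) (hδ : 0 < δ)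
    (hφ : ∀ x y, ‖φ x - φ y‖ ≤ α + β * (x - y) ^ 2 + γ * y ^ 2)
    (t : ℕ) (N : Move → ℕ) (s : ℤ) (hN : ∀ i, N i ≤ n) (ht : ∑ i, N i + t = 3 * n)
    {k : Move} (hk : n ≤ N k) :
    ‖(gStep ρ ν n)^[t] (fun x => φ x.2) (N, s) - uStep^[t] (fun x => φ (freeScore x)) (N, s)‖ ≤
      2 * α + 8 * β * (3 / 2 * δ + (sqDiff (realVec N) + 2 * t) / (2 * δ)) +
        4 * γ * (s ^ 2 + 2 / 3 * t + sqDiff (realVec N) + 2 * t) := by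
  have hNk : N k = n := le_antisymm (hN k) hk
  obtain ⟨a, ha⟩ := Nat.exists_eq_add_of_le (hN (k + 1))
  obtain ⟨b, hb⟩ := Nat.exists_eq_add_of_le (hN (k + 2))
  rw [sum_move k] at ht
  have hab : a + b = t := by omega
  have ha' : (n : ℝ) = N (k + 1) + a := by exact_mod_cast ha
  have hb' : (n : ℝ) = N (k + 2) + b := by exact_mod_cast hb
  have hk' : (N k : ℝ) = n := by exact_mod_cast hNk
  have d0 : realVec N k - realVec N (k + 1) = a := by simp only [realVec]; linarith
  have d1 : realVec N (k + 1) - realVec N (k + 2) = b - a := by simp only [realVec]; linarith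
  have d2 : realVec N (k + 2) - realVec N k = -b := by simp only [realVec]; linarith
  have hm : maxDiff (realVec N) = b / 2 + |2 * (a : ℝ) - b| / 2 := by
    rw [maxDiff_eq k, d0, d1, d2, max_eq_half_add_abs a.cast_nonneg b.cast_nonneg]
  have hq := sqDiff_eq k (realVec N)
  rw [d0, d1, d2] at hq
  set y : ℝ := s + maxDiff (realVec N) with hy
  have hA := norm_gStep_iterate_sub_le hρ hν (φ := φ) (v := φ y) (c := s + b / 2)
    (e := 2 * (a : ℝ) - b) (a0 := α + γ * y ^ 2) (b0 := β) (fun x => by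
      have h := hφ x y
      rw [hy, hm] at h ⊢
      refine h.trans (le_of_eq ?_)
      ring) hβ t a b hab s hk ha.symm hb.symm
  have hB := norm_uStep_iterate_sub_le (φ := φ) (v := φ y) (c := s) (z := realVec N)
    (a0 := α + γ * y ^ 2) (b0 := β) (fun x => by linarith [hφ x y]) hβ t N s
  have h0 : sqDiff (realVec N - realVec N) = 0 := by simp [sqDiff]
  rw [h0] at hB
  have htri := norm_sub_le_norm_sub_add_norm_sub
    ((gStep ρ ν n)^[t] (fun x => φ x.2) (N, s)) (φ y)
    (uStep^[t] (fun x => φ (freeScore x)) (N, s))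
  rw [norm_sub_rev (φ y)] at htri
  have hab' : (t : ℝ) = a + b := by exact_mod_cast hab.symm
  have ht0 : (0 : ℝ) ≤ t := t.cast_nonneg
  have hq0 := sqDiff_nonneg (realVec N)
  have hy2 : y ^ 2 ≤ 2 * s ^ 2 + 2 * sqDiff (realVec N) := by
    have := sq_maxDiff_le (realVec N)
    nlinarith [sq_nonneg (s - maxDiff (realVec N))]
  -- From `2aδ ≤ a² + δ²`, likewise for `b`, and `a² + b² ≤ sqDiff`.
  have htδ : (t : ℝ) ≤ 3 / 2 * δ + sqDiff (realVec N) / (2 * δ) := by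
    have : (t - 3 / 2 * δ) * (2 * δ) ≤ sqDiff (realVec N) := by
      rw [hq, hab']
      nlinarith [sq_nonneg (a - δ), sq_nonneg (b - δ), sq_nonneg ((b : ℝ) - a)]
    have := (le_div_iff₀ (by positivity : 0 < 2 * δ)).2 this
    linarith
  have h1 : sqDiff (realVec N) / (2 * δ) ≤ (sqDiff (realVec N) + 2 * t) / (2 * δ) := by
    gcongr
    linarith
  have h2 : β * t ≤ β * (3 / 2 * δ + (sqDiff (realVec N) + 2 * t) / (2 * δ)) :=
    mul_le_mul_of_nonneg_left (by linarith) hβ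
  have h3 : γ * y ^ 2 ≤ γ * (2 * (s ^ 2 + 2 / 3 * t + sqDiff (realVec N) + 2 * t)) :=
    mul_le_mul_of_nonneg_left (by linarith) hγ
  have h4 : 0 ≤ β * t := by positivity
  simp only [sub_self] at hA hB
  linarith

/-- Before any choice is exhausted the greedy game is the free game, and the bound is a martingale.
Hence the two games have asymptotically the same final score. -/
lemma norm_gStep_sub_uStep_le {ρ ν : Finset Move → PMF Move} (hρ : IsGreedyR ρ)
    (hν : IsGreedyN ν) {n : ℕ} {φ : ℝ → E} {α β γ δ : ℝ} (hβ : 0 ≤ β) (hγ : 0 ≤ γ) (hδ : 0 < δ)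
    (hφ : ∀ x y, ‖φ x - φ y‖ ≤ α + β * (x - y) ^ 2 + γ * y ^ 2)
    (t : ℕ) (N : Move → ℕ) (s : ℤ) (hN : ∀ i, N i ≤ n) (ht : ∑ i, N i + t = 3 * n) :
    ‖(gStep ρ ν n)^[t] (fun x => φ x.2) (N, s) - uStep^[t] (fun x => φ (freeScore x)) (N, s)‖ ≤
      2 * α + 8 * β * (3 / 2 * δ + (sqDiff (realVec N) + 2 * t) / (2 * δ)) +
        4 * γ * (s ^ 2 + 2 / 3 * t + sqDiff (realVec N) + 2 * t) := by
  induction t generalizing N s with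
  | zero =>
    -- With no round left all counts equal `n`, so any choice is exhausted.
    refine norm_gStep_sub_uStep_le_of_exhausted hρ hν hβ hγ hδ hφ 0 N s hN ht (k := 0) ?_
    have h0 := hN 0
    have h1 := hN 1
    have h2 := hN 2
    rw [Fin.sum_univ_three] at ht
    omega
  | succ t ih =>
    by_cases hk : ∃ k, n ≤ N k
    · obtain ⟨k, hk⟩ := hk
      exact norm_gStep_sub_uStep_le_of_exhausted hρ hν hβ hγ hδ hφ (t + 1) N s hN ht hk
    push Not at hk
    rw [Function.iterate_succ_apply', Function.iterate_succ_apply', gStep_univ hρ hν _ hk,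
      uStep_sub, ← sub_zero (uStep _ _)]
    refine (norm_uStep_sub_le (G := fun r m => 2 * α + 8 * β * (3 / 2 * δ +
      (sqDiff (realVec N + Pi.single r 1) + 2 * t) / (2 * δ)) +
        4 * γ * ((s + gain r m) ^ 2 + 2 / 3 * t + sqDiff (realVec N + Pi.single r 1) + 2 * t))
        fun r m => ?_).trans ?_
    · rw [sub_zero, Pi.sub_apply]
      refine (ih (N + Pi.single r 1) (s + gain r m) (fun i => ?_) ?_).trans (le_of_eq ?_)
      · have := hk i
        by_cases hi : i = r
        · subst hi; simpa using this
        · simpa [hi] using this.le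
      · simp only [Pi.add_apply, Finset.sum_add_distrib, Finset.sum_pi_single', Finset.mem_univ,
          if_true]
        omega
      · rw [realVec_add_single]
        push_cast
        rfl
    · have inner (r : Move) := sum_sq_add_gain s r
      have outer := sum_sqDiff_add_single (realVec N)
      simp only [Fin.sum_univ_three] at inner outer ⊢
      have i0 := inner 0
      have i1 := inner 1
      have i2 := inner 2
      push_cast
      apply le_of_eq
      field_simp
      linear_combination (72 * β + 72 * γ * δ) * outer + 24 * γ * δ * (i0 + i1 + i2)

end compare

/-! ### The free game -/

section free

variable {E : Type*} [NormedAddCommGroup E] [NormedSpace ℝ E]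

/-- One step of the uniform random walk counting the moves of R. -/
noncomputable def moveStep (G : (Move → ℕ) → E) (N : Move → ℕ) : E :=
  ∑ r : Move, (1 / 3 : ℝ) • G (N + Pi.single r 1)

/-- One step of the lazy random walk of the score. -/
noncomputable def gainStep (F : ℤ → E) (s : ℤ) : E :=
  (1 / 3 : ℝ) • (F s + F (s + 1) + F (s - 1))

lemma sum_add_gain (F : ℤ → E) (s : ℤ) (r : Move) :
    ∑ m, (1 / 3 : ℝ) • F (s + gain r m) = gainStep F s := by
  obtain ⟨h0, h1, h2⟩ := gain_table r
  rw [sum_move r, h0, h1, h2, gainStep, smul_add, smul_add, add_zero, sub_eq_add_neg]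

/-- Independence of score and counts: given any move of R, the gain is uniform on `{0, 1, -1}`. -/
lemma uStep_iterate_mul {A : Type*} [NormedRing A] [NormedAlgebra ℝ A] (F : ℤ → A)
    (G : (Move → ℕ) → A) (t : ℕ) (N : Move → ℕ) (s : ℤ) :
    uStep^[t] (fun x => F x.2 * G x.1) (N, s) = gainStep^[t] F s * moveStep^[t] G N := by
  induction t generalizing N s with
  | zero => rfl
  | succ t ih =>
    simp only [Function.iterate_succ_apply', uStep, ih]
    rw [moveStep, Finset.mul_sum]
    refine Finset.sum_congr rfl fun r _ => ?_
    rw [← sum_add_gain _ s r, mul_smul_comm, Finset.sum_mul]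
    simp only [smul_mul_assoc]

lemma uStep_iterate_add (f g : (Move → ℕ) × ℤ → E) (t : ℕ) (x : (Move → ℕ) × ℤ) :
    uStep^[t] (fun x => f x + g x) x = uStep^[t] f x + uStep^[t] g x := by
  induction t generalizing x with
  | zero => rfl
  | succ t ih =>
    simp only [Function.iterate_succ_apply', uStep, ih, smul_add, Finset.sum_add_distrib]

lemma uStep_iterate_smul (c : ℝ) (f : (Move → ℕ) × ℤ → E) (t : ℕ) (x : (Move → ℕ) × ℤ) :
    uStep^[t] (fun x => c • f x) x = c • uStep^[t] f x := by
  induction t generalizing x with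
  | zero => rfl
  | succ t ih =>
    simp only [Function.iterate_succ_apply', uStep, ih, Finset.smul_sum, smul_comm c]

lemma moveStep_iterate_const (c : E) (t : ℕ) (N : Move → ℕ) :
    moveStep^[t] (fun _ => c) N = c := by
  induction t generalizing N with
  | zero => rfl
  | succ t ih =>
    simp only [Function.iterate_succ_apply', moveStep, ih]
    rw [← Finset.sum_smul]
    norm_num

lemma gainStep_iterate_const (c : E) (t : ℕ) (s : ℤ) : gainStep^[t] (fun _ => c) s = c := by
  induction t generalizing s with
  | zero => rfl
  | succ t ih =>
    simp only [Function.iterate_succ_apply', gainStep, ih]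
    module

lemma gainStep_iterate_cast (t : ℕ) (s : ℤ) : gainStep^[t] (fun s : ℤ => (s : ℝ)) s = s := by
  induction t generalizing s with
  | zero => rfl
  | succ t ih =>
    simp only [Function.iterate_succ_apply', gainStep, ih, smul_eq_mul]
    push_cast
    ring

lemma gainStep_iterate_sq (t : ℕ) (s : ℤ) :
    gainStep^[t] (fun s : ℤ => (s : ℝ) ^ 2) s = s ^ 2 + 2 / 3 * t := by
  induction t generalizing s with
  | zero => simp
  | succ t ih =>
    simp only [Function.iterate_succ_apply', gainStep, ih, smul_eq_mul]
    push_cast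
    ring

lemma gainStep_iterate_exp (u : ℝ) (t : ℕ) (s : ℤ) :
    gainStep^[t] (fun s : ℤ => Complex.exp (u * s * Complex.I)) s =
      ((1 / 3 : ℝ) • ∑ r, Complex.exp ((u * ![0, 1, -1] r : ℝ) * Complex.I)) ^ t *
        Complex.exp (u * s * Complex.I) := by
  induction t generalizing s with
  | zero => simp
  | succ t ih =>
    simp only [Function.iterate_succ_apply', gainStep, ih, Fin.sum_univ_three]
    have e1 : Complex.exp (u * ((s + 1 : ℤ) : ℂ) * Complex.I) =
        Complex.exp ((u * 1 : ℝ) * Complex.I) * Complex.exp (u * s * Complex.I) := by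
      rw [← Complex.exp_add]; congr 1; push_cast; ring
    have e2 : Complex.exp (u * ((s - 1 : ℤ) : ℂ) * Complex.I) =
        Complex.exp ((u * (-1) : ℝ) * Complex.I) * Complex.exp (u * s * Complex.I) := by
      rw [← Complex.exp_add]; congr 1; push_cast; ring
    rw [e1, e2]
    simp only [Complex.real_smul, Matrix.cons_val_zero, Matrix.cons_val_one, Matrix.cons_val_two,
      Matrix.tail_cons, Matrix.head_cons, mul_zero, Complex.ofReal_zero, zero_mul,
      Complex.exp_zero]
    ring

lemma moveStep_iterate_exp (v : Fin 3 → ℝ) (t : ℕ) (N : Move → ℕ) :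
    moveStep^[t] (fun N => Complex.exp ((∑ i, v i * N i : ℝ) * Complex.I)) N =
      ((1 / 3 : ℝ) • ∑ r, Complex.exp (v r * Complex.I)) ^ t *
        Complex.exp ((∑ i, v i * N i : ℝ) * Complex.I) := by
  induction t generalizing N with
  | zero => simp
  | succ t ih =>
    simp only [Function.iterate_succ_apply', moveStep, ih]
    have e (r : Move) : Complex.exp ((∑ i, v i * ((N + Pi.single r 1 : Move → ℕ) i : ℝ) : ℝ) * Complex.I) =
        Complex.exp (v r * Complex.I) * Complex.exp ((∑ i, v i * N i : ℝ) * Complex.I) := by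
      rw [← Complex.exp_add, ← add_mul, ← Complex.ofReal_add]
      congr 3
      simp only [Pi.add_apply, Nat.cast_add, mul_add, Finset.sum_add_distrib]
      rw [add_comm]
      congr 1
      rw [Finset.sum_eq_single r] <;> simp +contextual
    simp only [e]
    rw [pow_succ, Finset.smul_sum]
    simp only [Finset.mul_sum, Finset.sum_mul, Complex.real_smul]
    refine Finset.sum_congr rfl fun r _ => ?_
    ring

/-- The sum of the fourth powers of the cyclic differences. -/
def quartDiff (x : Fin 3 → ℝ) : ℝ := (x 0 - x 1) ^ 4 + (x 1 - x 2) ^ 4 + (x 2 - x 0) ^ 4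

lemma sum_quartDiff_add_single (x : Fin 3 → ℝ) :
    ∑ r, quartDiff (x + Pi.single r 1) = 3 * quartDiff x + 12 * sqDiff x + 6 := by
  simp [Fin.sum_univ_three, quartDiff, sqDiff]
  ring

lemma maxDiff_pow_four_le (x : Fin 3 → ℝ) : maxDiff x ^ 4 ≤ quartDiff x := by
  have h : maxDiff x = x 0 - x 1 ∨ maxDiff x = x 1 - x 2 ∨ maxDiff x = x 2 - x 0 := by
    unfold maxDiff
    grind
  unfold quartDiff
  rcases h with h | h | h <;> rw [h] <;> nlinarith [sq_nonneg ((x 0 - x 1) ^ 2),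
    sq_nonneg ((x 1 - x 2) ^ 2), sq_nonneg ((x 2 - x 0) ^ 2)]

/-- One step adds on average `4 * sqDiff + 2` to `quartDiff` and `2` to `sqDiff`, which the
polynomial in `t` absorbs. -/
lemma moveStep_iterate_pow_four_le (t : ℕ) (N : Move → ℕ) :
    moveStep^[t] (fun N => maxDiff (realVec N) ^ 4) N ≤
      quartDiff (realVec N) + 4 * t * sqDiff (realVec N) + 4 * t ^ 2 := by
  induction t generalizing N with
  | zero => simpa using maxDiff_pow_four_le (realVec N)
  | succ t ih =>
    rw [Function.iterate_succ_apply', moveStep]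
    refine (Finset.sum_le_sum fun r _ => smul_le_smul_of_nonneg_left (ih (N + Pi.single r 1))
      (by norm_num)).trans ?_
    have h4 := sum_quartDiff_add_single (realVec N)
    have h2 := sum_sqDiff_add_single (realVec N)
    simp only [realVec_add_single, smul_eq_mul, Fin.sum_univ_three] at h2 h4 ⊢
    push_cast
    nlinarith

/-! ### The law of the free walk -/

/-- The law of the free walk counting the moves of R, started at `N`. -/
noncomputable def walkFrom : ℕ → (Move → ℕ) → PMF (Move → ℕ)
  | 0 => fun N => PMF.pure N
  | t + 1 => fun N => (PMF.uniformOfFintype Move).bind fun r => walkFrom t (N + Pi.single r 1)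

lemma integral_walkFrom [CompleteSpace E] (t : ℕ) (G : (Move → ℕ) → E) (N : Move → ℕ) :
    Integrable G (walkFrom t N).toMeasure ∧
      ∫ M, G M ∂(walkFrom t N).toMeasure = moveStep^[t] G N := by
  induction t generalizing N with
  | zero =>
    have : (walkFrom 0 N).toMeasure = Measure.dirac N := PMF.toMeasure_pure _
    rw [this]
    exact ⟨integrable_dirac (by simp), by simp⟩
  | succ t ih =>
    have h1 := integral_bind_of_fintype (PMF.uniformOfFintype Move)
      (fun r => walkFrom t (N + Pi.single r 1)) (fun r => (ih _).1)
    refine ⟨h1.1, h1.2.trans ?_⟩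
    rw [Function.iterate_succ_apply']
    refine Finset.sum_congr rfl fun r _ => ?_
    rw [(ih _).2]
    congr 1
    simp [PMF.uniformOfFintype_apply]

end free

/-! ### Characteristic functions -/

lemma tendsto_mul_exp_sub_one_sub (a : ℝ) :
    Tendsto (fun n : ℕ => (n : ℂ) * (Complex.exp ((a / √n : ℝ) * Complex.I) - 1 -
      (a / √n : ℝ) * Complex.I)) atTop (nhds (-(a : ℂ) ^ 2 / 2)) := by
  have hO := Complex.exp_sub_sum_range_isBigO_pow 3
  have hz0 : Tendsto (fun n : ℕ => a / √(n : ℝ)) atTop (nhds 0) :=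
    Tendsto.div_atTop tendsto_const_nhds (Real.tendsto_sqrt_atTop.comp tendsto_natCast_atTop_atTop)
  have hz : Tendsto (fun n : ℕ => ((a / √n : ℝ) : ℂ) * Complex.I) atTop (nhds 0) := by
    have := (Complex.continuous_ofReal.tendsto 0).comp hz0
    simpa using this.mul_const Complex.I
  have h1 := (hO.comp_tendsto hz)
  have h2 : (fun n : ℕ => (n : ℂ) * (Complex.exp ((a / √n : ℝ) * Complex.I) - 1 -
      (a / √n : ℝ) * Complex.I) - (-(a : ℂ) ^ 2 / 2)) =O[atTop]
      fun n : ℕ => (n : ℂ) * (((a / √n : ℝ) : ℂ) * Complex.I) ^ 3 := by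
    refine ((Asymptotics.isBigO_refl (fun n : ℕ => (n : ℂ)) atTop).mul h1).congr' ?_ .rfl
    filter_upwards [eventually_gt_atTop 0] with n hn
    have hs : ((√(n : ℝ) : ℝ) : ℂ) ^ 2 = n := by
      rw [← Complex.ofReal_pow, Real.sq_sqrt n.cast_nonneg, Complex.ofReal_natCast]
    have hs0 : ((√(n : ℝ) : ℝ) : ℂ) ≠ 0 := by
      intro h; rw [h] at hs; simp at hs; exact hn.ne (by exact_mod_cast hs)
    simp only [Function.comp_apply, Finset.sum_range_succ, Finset.sum_range_zero]
    push_cast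
    simp only [Nat.factorial]
    rw [← hs]
    field_simp
    ring_nf
    simp only [Complex.I_sq]
    ring
  have h3 : Tendsto (fun n : ℕ => (n : ℂ) * (((a / √n : ℝ) : ℂ) * Complex.I) ^ 3) atTop
      (nhds 0) := by
    have h4 : Tendsto (fun n : ℕ => (((a / √n : ℝ) : ℂ) * Complex.I) * (-(a : ℂ) ^ 2)) atTop
        (nhds (0 * (-(a : ℂ) ^ 2))) := hz.mul_const _
    rw [zero_mul] at h4
    refine h4.congr' ?_
    filter_upwards [eventually_gt_atTop 0] with n hn
    have hs : ((√(n : ℝ) : ℝ) : ℂ) ^ 2 = n := by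
      rw [← Complex.ofReal_pow, Real.sq_sqrt n.cast_nonneg, Complex.ofReal_natCast]
    have hs0 : ((√(n : ℝ) : ℝ) : ℂ) ≠ 0 := by
      intro h; rw [h] at hs; simp at hs; exact hn.ne (by exact_mod_cast hs)
    push_cast
    rw [← hs]
    field_simp
    simp only [Complex.I_sq]
    ring
  exact tendsto_sub_nhds_zero_iff.1 (h2.trans_tendsto h3)

/-- Central limit theorem for a step uniform on three values; the zero sum removes the first-order
term. It serves both the counts and the score. -/
lemma tendsto_avg_exp_pow (v : Fin 3 → ℝ) (hv : ∑ i, v i = 0) :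
    Tendsto (fun n : ℕ =>
      ((1 / 3 : ℝ) • ∑ r, Complex.exp ((v r / √n : ℝ) * Complex.I)) ^ (3 * n)) atTop
      (nhds (Complex.exp (-((∑ i, v i ^ 2 : ℝ) : ℂ) / 2))) := by
  have h1 : Tendsto (fun n : ℕ => (n : ℂ) *
      ((1 / 3 : ℝ) • ∑ r, Complex.exp ((v r / √n : ℝ) * Complex.I) - 1)) atTop
      (nhds ((1 / 3 : ℝ) • ∑ r, (-(v r : ℂ) ^ 2 / 2))) := by
    refine ((tendsto_finsetSum Finset.univ fun r _ =>
      tendsto_mul_exp_sub_one_sub (v r)).const_smul (1 / 3 : ℝ)).congr fun n => ?_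
    have hv' : (v 0 : ℂ) + v 1 + v 2 = 0 := by
      rw [Fin.sum_univ_three] at hv
      exact_mod_cast hv
    simp only [Fin.sum_univ_three, Complex.real_smul]
    push_cast
    linear_combination (-(n : ℂ) * (√(n : ℝ) : ℂ)⁻¹ * Complex.I / 3) * hv'
  have h2 := (Complex.tendsto_one_add_pow_exp_of_tendsto h1).pow 3
  rw [← Complex.exp_nat_mul] at h2
  convert h2 using 2
  · rw [add_sub_cancel, ← pow_mul, mul_comm]
  · congr 1
    simp only [Fin.sum_univ_three, Complex.real_smul]
    push_cast
    ring

/-! ### The Gaussian vector `V` -/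

/-- `covV` is the orthogonal projection onto the plane of vectors with zero sum. -/
lemma covV_eq_conjTranspose_mul : covV = covV.conjTranspose * covV := by
  ext i j
  fin_cases i <;> fin_cases j <;>
    simp [covV, Matrix.mul_apply, Fin.sum_univ_three] <;> norm_num

lemma posSemidef_covV : covV.PosSemidef := by
  rw [covV_eq_conjTranspose_mul]
  exact Matrix.posSemidef_conjTranspose_mul_self covV

/-- The law of `V`. -/
noncomputable abbrev lawV : Measure (EuclideanSpace ℝ (Fin 3)) := multivariateGaussian 0 covV

lemma charFun_lawV (x : EuclideanSpace ℝ (Fin 3)) :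
    charFun lawV x = Complex.exp (-((∑ i, (x i - (∑ j, x j) / 3) ^ 2 : ℝ) : ℂ) / 2) := by
  rw [lawV, charFun_multivariateGaussian posSemidef_covV]
  congr 1
  simp only [inner_zero_right, Complex.ofReal_zero, zero_mul, zero_sub, neg_div, neg_inj]
  congr 2
  simp [covV, Matrix.mulVec, dotProduct, Fin.sum_univ_three]
  ring

/-- The part of `S*` that depends on `V`. -/
noncomputable def topV (x : EuclideanSpace ℝ (Fin 3)) : ℝ :=
  max (x 0 + 2 * x 1) (max (x 1 + 2 * x 2) (x 2 + 2 * x 0))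

lemma Sstar_eq (ω : ℝ × EuclideanSpace ℝ (Fin 3)) : Sstar ω = ω.1 + topV ω.2 := rfl

@[fun_prop]
lemma continuous_topV : Continuous topV := by
  unfold topV
  fun_prop

lemma abs_topV_le (x : EuclideanSpace ℝ (Fin 3)) : |topV x| ≤ 3 * ‖x‖ := by
  have h (i : Fin 3) := abs_le.1 ((Real.norm_eq_abs _).symm.trans_le (PiLp.norm_apply_le x i))
  have h0 := h 0
  have h1 := h 1
  have h2 := h 2
  unfold topV
  rw [abs_le]
  refine ⟨le_max_of_le_left (by linarith), max_le (by linarith) (max_le ?_ ?_)⟩ <;> linarith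

lemma memLp_topV (p : ENNReal) (hp : p ≠ ⊤) : MemLp topV p lawV := by
  have h : MemLp (id : EuclideanSpace ℝ (Fin 3) → _) p lawV := IsGaussian.memLp_id _ p hp
  refine (h.norm.const_mul 3).mono continuous_topV.aestronglyMeasurable
    (Eventually.of_forall fun x => ?_)
  rw [Real.norm_eq_abs, Real.norm_of_nonneg (by positivity)]
  exact abs_topV_le x

/-- A linear image of the standard Gaussian law of the plane which has the law of `V`. -/
noncomputable def planeMap (p : ℝ × ℝ) : EuclideanSpace ℝ (Fin 3) :=
  !₂[2 * p.2 / √6, p.1 / √2 - p.2 / √6, -p.1 / √2 - p.2 / √6]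

@[fun_prop]
lemma continuous_planeMap : Continuous planeMap := by
  unfold planeMap
  fun_prop

lemma map_planeMap :
    ((gaussianReal 0 1).prod (gaussianReal 0 1)).map planeMap = lawV := by
  have : IsProbabilityMeasure (((gaussianReal 0 1).prod (gaussianReal 0 1)).map planeMap) :=
    Measure.isProbabilityMeasure_map (by fun_prop)
  apply Measure.ext_of_charFun
  ext x
  rw [charFun_lawV, charFun_apply, integral_map (by fun_prop) (by fun_prop)]
  have h (p : ℝ × ℝ) : Complex.exp ((inner ℝ (planeMap p) x : ℝ) * Complex.I) =
      Complex.exp (((x 1 - x 2) / √2 : ℝ) * p.1 * Complex.I) *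
        Complex.exp (((2 * x 0 - x 1 - x 2) / √6 : ℝ) * p.2 * Complex.I) := by
    rw [← Complex.exp_add]
    congr 1
    simp [planeMap, PiLp.inner_apply, Fin.sum_univ_three]
    ring
  simp only [h]
  rw [integral_prod_mul (fun a : ℝ => Complex.exp (((x 1 - x 2) / √2 : ℝ) * a * Complex.I))
    (fun b : ℝ => Complex.exp (((2 * x 0 - x 1 - x 2) / √6 : ℝ) * b * Complex.I)),
    ← charFun_apply_real, ← charFun_apply_real, charFun_gaussianReal, charFun_gaussianReal,
    ← Complex.exp_add]
  congr 1
  have h2 : (√2 : ℂ) ^ 2 = 2 := by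
    rw [← Complex.ofReal_pow, Real.sq_sqrt (by norm_num)]; norm_num
  have h6 : (√6 : ℂ) ^ 2 = 6 := by
    rw [← Complex.ofReal_pow, Real.sq_sqrt (by norm_num)]; norm_num
  simp only [Fin.sum_univ_three]
  push_cast
  simp only [div_pow, h2, h6]
  ring

/-- The function of the plane that corresponds to `topV`, up to the factor `√2`. -/
noncomputable def topPlane (p : ℝ × ℝ) : ℝ :=
  max p.1 (max (-p.1 / 2 - √3 / 2 * p.2) (-p.1 / 2 + √3 / 2 * p.2))

/-- `planeMap` is an isometry onto the zero-sum plane. There the three linear forms are differences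
of coordinates, that is, `√2` times inner products with unit vectors at angles `0` and `±2π/3`. -/
lemma topV_planeMap (p : ℝ × ℝ) : topV (planeMap p) = √2 * topPlane p := by
  have h2 : √2 * √2 = 2 := Real.mul_self_sqrt (by norm_num)
  have h3 : √3 * √3 = 3 := Real.mul_self_sqrt (by norm_num)
  have h6 : √6 = √2 * √3 := by rw [← Real.sqrt_mul (by norm_num)]; norm_num
  have p2 : 0 < √2 := by positivity
  have p3 : 0 < √3 := by positivity
  unfold topV topPlane
  rw [mul_max_of_nonneg _ _ p2.le, mul_max_of_nonneg _ _ p2.le]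
  simp only [planeMap, PiLp.toLp_apply, Matrix.cons_val_zero, Matrix.cons_val_one, Matrix.cons_val,
    h6]
  congr 1
  · field_simp
    linear_combination (-p.1 * √3) * h2
  · congr 1
    · field_simp
      linear_combination (√3 * p.1) * h2 + (√2 ^ 2 * p.2) * h3 + 3 * p.2 * h2
    · field_simp
      linear_combination (√3 * p.1) * h2 - (√2 ^ 2 * p.2) * h3 - 3 * p.2 * h2

lemma integral_prod_gaussianReal (f : ℝ × ℝ → ℝ) :
    ∫ p, f p ∂((gaussianReal 0 1).prod (gaussianReal 0 1)) =
      ∫ p : ℝ × ℝ, (2 * π)⁻¹ * Real.exp (-(p.1 ^ 2 + p.2 ^ 2) / 2) * f p := by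
  rw [gaussianReal_of_var_ne_zero 0 one_ne_zero, prod_withDensity (by fun_prop) (by fun_prop),
    integral_withDensity_eq_integral_toReal_smul (by fun_prop)
      (Eventually.of_forall fun p => ENNReal.mul_lt_top (by simp [gaussianPDF])
        (by simp [gaussianPDF]))]
  rw [← Measure.volume_eq_prod]
  congr 1
  ext p
  simp only [gaussianPDF, gaussianPDFReal, smul_eq_mul, ENNReal.toReal_mul, NNReal.coe_one, mul_one,
    sub_zero]
  rw [ENNReal.toReal_ofReal (by positivity), ENNReal.toReal_ofReal (by positivity)]
  have h : (√(2 * π))⁻¹ * (√(2 * π))⁻¹ = (2 * π)⁻¹ := by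
    rw [← mul_inv, Real.mul_self_sqrt (by positivity)]
  have e : Real.exp (-(p.1 ^ 2 + p.2 ^ 2) / 2) =
      Real.exp (-p.1 ^ 2 / 2) * Real.exp (-p.2 ^ 2 / 2) := by
    rw [← Real.exp_add]; congr 1; ring
  rw [e, ← h]
  ring

lemma topPlane_polar {r : ℝ} (hr : 0 ≤ r) (θ : ℝ) :
    topPlane (r * Real.cos θ, r * Real.sin θ) = r * topPlane (Real.cos θ, Real.sin θ) := by
  unfold topPlane
  rw [mul_max_of_nonneg _ _ hr, mul_max_of_nonneg _ _ hr]
  simp only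
  congr 1
  congr 1 <;> ring

/-- Homogeneity of `topPlane` splits the Gaussian moment into a radial and an angular integral. -/
lemma integral_topPlane_pow (k : ℕ) :
    ∫ p, topPlane p ^ k ∂((gaussianReal 0 1).prod (gaussianReal 0 1)) =
      (2 * π)⁻¹ * (∫ r in Set.Ioi (0 : ℝ), r ^ (k + 1) * Real.exp (-r ^ 2 / 2)) *
        ∫ θ in (-π)..π, topPlane (Real.cos θ, Real.sin θ) ^ k := by
  rw [integral_prod_gaussianReal, ← integral_comp_polarCoord_symm, polarCoord_target,
    intervalIntegral.integral_of_le (by linarith [Real.pi_pos]), integral_Ioc_eq_integral_Ioo,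
    mul_assoc, ← setIntegral_prod_mul,
    ← integral_const_mul, Measure.volume_eq_prod]
  refine setIntegral_congr_fun (measurableSet_Ioi.prod measurableSet_Ioo) fun p hp => ?_
  have hr : 0 ≤ p.1 := le_of_lt hp.1
  simp only [polarCoord_symm_apply, topPlane_polar hr, smul_eq_mul]
  have : -((p.1 * Real.cos p.2) ^ 2 + (p.1 * Real.sin p.2) ^ 2) / 2 = -p.1 ^ 2 / 2 := by
    have := Real.sin_sq_add_cos_sq p.2
    linear_combination (-p.1 ^ 2 / 2) * this
  rw [this]
  ring

lemma integral_sq_mul_exp :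
    ∫ r in Set.Ioi (0 : ℝ), r ^ (1 + 1) * Real.exp (-r ^ 2 / 2) = √(π / 2) := by
  have h := integral_rpow_mul_exp_neg_mul_rpow (p := 2) (q := 2) (b := 1 / 2) (by norm_num)
    (by norm_num) (by norm_num)
  have e : ∀ r : ℝ, r ^ (1 + 1) * Real.exp (-r ^ 2 / 2) =
      r ^ (2 : ℝ) * Real.exp (-(1 / 2) * r ^ (2 : ℝ)) := by
    intro r
    rw [Real.rpow_two]
    ring_nf
  simp only [e]
  rw [h, show ((2 : ℝ) + 1) / 2 = 1 / 2 + 1 by norm_num, Real.Gamma_add_one (by norm_num),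
    Real.Gamma_one_half_eq, show (-(2 + 1) / 2 : ℝ) = -1 + -(1 / 2) by norm_num,
    Real.rpow_add (by norm_num), Real.rpow_neg_one, Real.rpow_neg (by norm_num),
    ← Real.sqrt_eq_rpow, Real.sqrt_div (by positivity), Real.sqrt_div (by positivity)]
  simp only [Real.sqrt_one, one_div, inv_inv]
  field_simp
  rw [Real.sq_sqrt (by norm_num)]

lemma integral_pow_three_mul_exp :
    ∫ r in Set.Ioi (0 : ℝ), r ^ (2 + 1) * Real.exp (-r ^ 2 / 2) = 2 := by
  have h := integral_rpow_mul_exp_neg_mul_rpow (p := 2) (q := 3) (b := 1 / 2) (by norm_num)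
    (by norm_num) (by norm_num)
  have e : ∀ r : ℝ, r ^ (2 + 1) * Real.exp (-r ^ 2 / 2) =
      r ^ (3 : ℝ) * Real.exp (-(1 / 2) * r ^ (2 : ℝ)) := by
    intro r
    rw [Real.rpow_two, show (3 : ℝ) = (3 : ℕ) by norm_num, Real.rpow_natCast]
    ring_nf
  simp only [e]
  rw [h, show ((3 : ℝ) + 1) / 2 = 1 + 1 by norm_num, Real.Gamma_add_one (by norm_num),
    Real.Gamma_one, show (-(3 + 1) / 2 : ℝ) = -1 + -1 by norm_num,
    Real.rpow_add (by norm_num), Real.rpow_neg_one]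
  norm_num

lemma topPlane_neg (a b : ℝ) : topPlane (a, -b) = topPlane (a, b) := by
  unfold topPlane
  simp only [mul_neg, sub_neg_eq_add, ← sub_eq_add_neg]
  rw [max_comm (-a / 2 + _)]

lemma topPlane_center {θ : ℝ} (h1 : -(π / 3) ≤ θ) (h2 : θ ≤ π / 3) :
    topPlane (Real.cos θ, Real.sin θ) = Real.cos θ := by
  have h3 : √3 * √3 = 3 := Real.mul_self_sqrt (by norm_num)
  have s1 : 0 ≤ Real.sin (π / 3 - θ) :=
    Real.sin_nonneg_of_nonneg_of_le_pi (by linarith) (by linarith [Real.pi_pos])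
  have s2 : 0 ≤ Real.sin (π / 3 + θ) :=
    Real.sin_nonneg_of_nonneg_of_le_pi (by linarith) (by linarith [Real.pi_pos])
  rw [Real.sin_sub, Real.sin_pi_div_three, Real.cos_pi_div_three] at s1
  rw [Real.sin_add, Real.sin_pi_div_three, Real.cos_pi_div_three] at s2
  have p1 := mul_nonneg (Real.sqrt_nonneg 3) s1
  have p2 := mul_nonneg (Real.sqrt_nonneg 3) s2
  exact max_eq_left (max_le (by simp only; nlinarith) (by simp only; nlinarith))

lemma topPlane_right {θ : ℝ} (h1 : π / 3 ≤ θ) (h2 : θ ≤ π) :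
    topPlane (Real.cos θ, Real.sin θ) = Real.cos (θ - 2 * π / 3) := by
  have h3 : √3 * √3 = 3 := Real.mul_self_sqrt (by norm_num)
  have s1 : 0 ≤ Real.sin (θ - π / 3) :=
    Real.sin_nonneg_of_nonneg_of_le_pi (by linarith) (by linarith [Real.pi_pos])
  have s2 : 0 ≤ Real.sin θ :=
    Real.sin_nonneg_of_nonneg_of_le_pi (by linarith [Real.pi_pos]) (by linarith [Real.pi_pos])
  rw [Real.sin_sub, Real.sin_pi_div_three, Real.cos_pi_div_three] at s1
  have p1 := mul_nonneg (Real.sqrt_nonneg 3) s1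
  have p2 := mul_nonneg (Real.sqrt_nonneg 3) s2
  have c : Real.cos (2 * π / 3) = -1 / 2 := by
    rw [show 2 * π / 3 = π - π / 3 by ring, Real.cos_pi_sub, Real.cos_pi_div_three]; ring
  have s : Real.sin (2 * π / 3) = √3 / 2 := by
    rw [show 2 * π / 3 = π - π / 3 by ring, Real.sin_pi_sub, Real.sin_pi_div_three]
  rw [Real.cos_sub, c, s]
  unfold topPlane
  rw [max_eq_right (b := -Real.cos θ / 2 + √3 / 2 * Real.sin θ)
    (show -Real.cos θ / 2 - √3 / 2 * Real.sin θ ≤ _ by nlinarith), max_eq_right (by nlinarith)]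
  ring

lemma topPlane_left {θ : ℝ} (h1 : -π ≤ θ) (h2 : θ ≤ -(π / 3)) :
    topPlane (Real.cos θ, Real.sin θ) = Real.cos (θ + 2 * π / 3) := by
  have h := topPlane_right (θ := -θ) (by linarith) (by linarith)
  rw [Real.cos_neg, Real.sin_neg, topPlane_neg] at h
  rw [h, ← Real.cos_neg]
  congr 1
  ring

/-- By threefold symmetry, each sector of width `2π/3`, where one unit vector dominates, contributes
the same. -/
lemma integral_topPlane_circle (k : ℕ) :
    ∫ θ in (-π)..π, topPlane (Real.cos θ, Real.sin θ) ^ k =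
      3 * ∫ θ in (-(π / 3))..(π / 3), Real.cos θ ^ k := by
  have hpi := Real.pi_pos
  have hc : Continuous fun θ : ℝ => topPlane (Real.cos θ, Real.sin θ) ^ k := by
    unfold topPlane
    fun_prop
  rw [← intervalIntegral.integral_add_adjacent_intervals (hc.intervalIntegrable (-π) (-(π / 3)))
    (hc.intervalIntegrable (-(π / 3)) π),
    ← intervalIntegral.integral_add_adjacent_intervals
      (hc.intervalIntegrable (-(π / 3)) (π / 3)) (hc.intervalIntegrable (π / 3) π)]
  have e1 : ∫ θ in (-π)..(-(π / 3)), topPlane (Real.cos θ, Real.sin θ) ^ k =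
      ∫ θ in (-(π / 3))..(π / 3), Real.cos θ ^ k := by
    rw [intervalIntegral.integral_congr (g := fun θ => Real.cos (θ + 2 * π / 3) ^ k) fun θ hθ => ?_,
      intervalIntegral.integral_comp_add_right (fun θ => Real.cos θ ^ k)]
    · congr 1 <;> ring
    · rw [Set.uIcc_of_le (by linarith)] at hθ
      simp only [topPlane_left hθ.1 hθ.2]
  have e2 : ∫ θ in (-(π / 3))..(π / 3), topPlane (Real.cos θ, Real.sin θ) ^ k =
      ∫ θ in (-(π / 3))..(π / 3), Real.cos θ ^ k := by
    refine intervalIntegral.integral_congr fun θ hθ => ?_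
    rw [Set.uIcc_of_le (by linarith)] at hθ
    simp only [topPlane_center hθ.1 hθ.2]
  have e3 : ∫ θ in (π / 3)..π, topPlane (Real.cos θ, Real.sin θ) ^ k =
      ∫ θ in (-(π / 3))..(π / 3), Real.cos θ ^ k := by
    rw [intervalIntegral.integral_congr (g := fun θ => Real.cos (θ - 2 * π / 3) ^ k) fun θ hθ => ?_,
      intervalIntegral.integral_comp_sub_right (fun θ => Real.cos θ ^ k)]
    · congr 1 <;> ring
    · rw [Set.uIcc_of_le (by linarith)] at hθ
      simp only [topPlane_right hθ.1 hθ.2]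
  rw [e1, e2, e3]
  ring

lemma integral_topV_pow (k : ℕ) : ∫ x, topV x ^ k ∂lawV =
    √2 ^ k * ((2 * π)⁻¹ * (∫ r in Set.Ioi (0 : ℝ), r ^ (k + 1) * Real.exp (-r ^ 2 / 2)) *
      (3 * ∫ θ in (-(π / 3))..(π / 3), Real.cos θ ^ k)) := by
  rw [← map_planeMap, integral_map (by fun_prop) (by fun_prop)]
  simp only [topV_planeMap, mul_pow]
  rw [integral_const_mul, integral_topPlane_pow, integral_topPlane_circle]

lemma integral_topV : ∫ x, topV x ∂lawV = 3 * √3 / (2 * √π) := by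
  have h := integral_topV_pow 1
  simp only [pow_one] at h
  have e := integral_sq_mul_exp
  rw [h, e, integral_cos, Real.sin_neg, Real.sin_pi_div_three, Real.sqrt_div Real.pi_pos.le]
  have hp : √π * √π = π := Real.mul_self_sqrt Real.pi_pos.le
  have : 0 < √π := Real.sqrt_pos.2 Real.pi_pos
  have : 0 < √2 := by positivity
  have key : (2 * π)⁻¹ * (√π / √2) = (2 * √π * √2)⁻¹ := by
    field_simp
    linear_combination hp
  rw [key]
  field_simp
  ring

lemma integral_topV_sq : ∫ x, topV x ^ 2 ∂lawV = 2 + 3 * √3 / (2 * π) := by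
  rw [integral_topV_pow 2, integral_pow_three_mul_exp, integral_cos_sq, Real.sin_neg, Real.cos_neg,
    Real.sin_pi_div_three, Real.cos_pi_div_three, Real.sq_sqrt (by norm_num)]
  have := Real.pi_pos
  field_simp
  ring

/-! ### Convergence of moments -/

lemma abs_sub_clamp_le {M : ℝ} (hM : 0 < M) (y : ℝ) : |y - max (-M) (min y M)| ≤ y ^ 2 / M := by
  rw [le_div_iff₀ hM]
  rcases le_total y M with h | h
  · rw [min_eq_left h]
    rcases le_total (-M) y with h' | h'
    · rw [max_eq_right h']; simp; positivity
    · rw [max_eq_left h', abs_of_nonpos (by linarith)]; nlinarith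
  · rw [min_eq_right h, max_eq_right (by linarith), abs_of_nonneg (by linarith)]; nlinarith

lemma abs_integral_sub_integral_clamp_le {Ω : Type*} {m : MeasurableSpace Ω} {μ : Measure Ω}
    [IsProbabilityMeasure μ] {Y : Ω → ℝ} (hY : MemLp Y 2 μ) {M C : ℝ} (hM : 0 < M)
    (hC : ∫ ω, Y ω ^ 2 ∂μ ≤ C) :
    |∫ ω, Y ω ∂μ - ∫ ω, max (-M) (min (Y ω) M) ∂μ| ≤ C / M := by
  have hi : Integrable Y μ := hY.integrable (by norm_num)
  have hc : Integrable (fun ω => max (-M) (min (Y ω) M)) μ :=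
    (integrable_const _).sup (hi.inf (integrable_const _))
  rw [← integral_sub hi hc]
  refine (abs_integral_le_integral_abs).trans ?_
  refine (integral_mono (hi.sub hc).abs (hY.integrable_sq.div_const M)
    fun ω => abs_sub_clamp_le hM (Y ω)).trans ?_
  rw [integral_div]
  gcongr

/-- Convergence in distribution with bounded second moments implies convergence of the means. -/
lemma tendsto_integral_of_tendstoInDistribution {Ω : ℕ → Type*} {Ω' : Type*}
    {m : ∀ n, MeasurableSpace (Ω n)} {m' : MeasurableSpace Ω'} {μ : ∀ n, Measure (Ω n)}
    [∀ n, IsProbabilityMeasure (μ n)] {μ' : Measure Ω'} [IsProbabilityMeasure μ']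
    {Y : ∀ n, Ω n → ℝ} {Z : Ω' → ℝ} (h : TendstoInDistribution Y atTop Z μ μ')
    (hY : ∀ n, MemLp (Y n) 2 (μ n)) (hZ : MemLp Z 2 μ') {C : ℝ}
    (hC : ∀ n, ∫ ω, Y n ω ^ 2 ∂(μ n) ≤ C) :
    Tendsto (fun n => ∫ ω, Y n ω ∂(μ n)) atTop (nhds (∫ ω, Z ω ∂μ')) := by
  set C' := max (max C (∫ ω, Z ω ^ 2 ∂μ')) 1 with hC'
  have hC0 : 0 < C' := lt_of_lt_of_le one_pos (le_max_right _ _)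
  rw [Metric.tendsto_atTop]
  intro ε hε
  -- Each of the two truncation errors is then at most `C' / M = ε / 3`.
  set M := 3 * C' / ε with hM
  have hM0 : 0 < M := by positivity
  have hCM : C' / M = ε / 3 := by rw [hM]; field_simp
  have hcont : Continuous fun y : ℝ => max (-M) (min y M) := by fun_prop
  let g : BoundedContinuousFunction ℝ ℝ := BoundedContinuousFunction.ofNormedAddCommGroup
    (fun y : ℝ => max (-M) (min y M)) hcont M (fun y => by
      rw [Real.norm_eq_abs, abs_le]
      exact ⟨le_max_left _ _, max_le (by linarith) (min_le_right _ _)⟩)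
  have hg := ProbabilityMeasure.tendsto_iff_forall_integral_tendsto.1 h.tendsto g
  have e1 (n : ℕ) : ∫ y, g y ∂((μ n).map (Y n)) = ∫ ω, max (-M) (min (Y n ω) M) ∂(μ n) :=
    integral_map (h.forall_aemeasurable n) hcont.aestronglyMeasurable
  have e2 : ∫ y, g y ∂(μ'.map Z) = ∫ ω, max (-M) (min (Z ω) M) ∂μ' :=
    integral_map h.aemeasurable_limit hcont.aestronglyMeasurable
  simp only [ProbabilityMeasure.coe_mk, e1, e2] at hg
  obtain ⟨n0, hn0⟩ := Metric.tendsto_atTop.1 hg (ε / 3) (by positivity)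
  refine ⟨n0, fun n hn => ?_⟩
  have h1 := hn0 n hn
  have h2 := abs_integral_sub_integral_clamp_le (hY n) hM0
    ((hC n).trans ((le_max_left _ _).trans (le_max_left _ _) : C ≤ C'))
  have h3 := abs_integral_sub_integral_clamp_le hZ hM0
    ((le_max_right _ _).trans (le_max_left _ _) : _ ≤ C')
  rw [hCM] at h2 h3
  rw [Real.dist_eq] at h1 ⊢
  rw [abs_le] at h2 h3
  rw [abs_lt] at h1 ⊢
  constructor <;> linarith

/-! ### The limit of the free walk -/

/-- The law of the numbers of the moves of R in the free game. -/
noncomputable abbrev walkLaw (n : ℕ) : Measure (Move → ℕ) := (walkFrom (3 * n) 0).toMeasure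

/-- The centred and normalized vector of the numbers of moves. -/
noncomputable def scaledVec (n : ℕ) (N : Move → ℕ) : EuclideanSpace ℝ (Fin 3) :=
  WithLp.toLp 2 fun i => (N i - (∑ j, (N j : ℝ)) / 3) / √n

/-- The coordinates of `scaledVec` sum to zero, so `x i + 2 * x (i + 1)` is the difference `x (i +
1) - x (i + 2)`, from which the centring cancels. -/
lemma topV_scaledVec (n : ℕ) (N : Move → ℕ) :
    topV (scaledVec n N) = maxDiff (realVec N) / √n := by
  have h : (0 : ℝ) ≤ (√n)⁻¹ := by positivity
  rw [maxDiff_eq 1]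
  unfold topV
  rw [div_eq_mul_inv, max_mul_of_nonneg _ _ h, max_mul_of_nonneg _ _ h]
  simp only [scaledVec, realVec, Fin.sum_univ_three]
  change max _ (max _ _) = max (((N 1 : ℝ) - N 2) * (√n)⁻¹)
    (max (((N 2 : ℝ) - N 0) * (√n)⁻¹) (((N 0 : ℝ) - N 1) * (√n)⁻¹))
  congr 1
  · ring
  · congr 1 <;> ring

lemma tendstoInDistribution_scaledVec :
    TendstoInDistribution scaledVec atTop id walkLaw lawV where
  forall_aemeasurable n := (measurable_of_countable _).aemeasurable
  aemeasurable_limit := aemeasurable_id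
  tendsto := by
    refine ProbabilityMeasure.tendsto_iff_tendsto_charFun.2 fun v => ?_
    -- Centring is moved from the walk to the test vector, which then has zero sum.
    set c : ℝ := (∑ j, v j) / 3 with hc
    have hv : ∑ i, (v i - c) = 0 := by
      rw [Finset.sum_sub_distrib]
      simp [hc]
      ring
    have h := tendsto_avg_exp_pow (fun i => v i - c) hv
    simp only [ProbabilityMeasure.coe_mk, Measure.map_id]
    rw [charFun_lawV]
    refine h.congr fun n => ?_
    rw [charFun_apply, integral_map (measurable_of_countable _).aemeasurable (by fun_prop)]
    have e (N : Move → ℕ) : inner ℝ (scaledVec n N) v = ∑ i, (v i - c) / √n * N i := by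
      simp only [scaledVec, PiLp.inner_apply, Fin.sum_univ_three, hc]
      simp
      ring
    simp only [e]
    rw [(integral_walkFrom _ _ _).2, moveStep_iterate_exp]
    simp

lemma tendstoInDistribution_topV :
    TendstoInDistribution (fun n => topV ∘ scaledVec n) atTop topV walkLaw lawV :=
  tendstoInDistribution_scaledVec.continuous_comp continuous_topV

lemma memLp_walkLaw (n : ℕ) (G : (Move → ℕ) → ℝ) : MemLp G 2 (walkLaw n) :=
  (memLp_two_iff_integrable_sq (measurable_of_countable _).aestronglyMeasurable).2
    (integral_walkFrom _ _ _).1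

lemma integral_pow_four_topV_scaledVec_le (n : ℕ) :
    ∫ N, topV (scaledVec n N) ^ 4 ∂(walkLaw n) ≤ 36 := by
  simp only [topV_scaledVec, div_pow]
  rw [integral_div, (integral_walkFrom _ _ _).2]
  have h := moveStep_iterate_pow_four_le (3 * n) 0
  have hs : (√(n : ℝ)) ^ 4 = (n : ℝ) ^ 2 := by
    rw [show 4 = 2 * 2 by norm_num, pow_mul, Real.sq_sqrt n.cast_nonneg]
  rw [hs]
  rcases Nat.eq_zero_or_pos n with rfl | hn
  · simp
  have hn' : (0 : ℝ) < n := by exact_mod_cast hn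
  rw [div_le_iff₀ (by positivity)]
  refine h.trans (le_of_eq ?_)
  simp [quartDiff, sqDiff, realVec]
  ring

lemma tendsto_moveStep_maxDiff :
    Tendsto (fun n : ℕ => moveStep^[3 * n] (fun N => maxDiff (realVec N)) 0 / √n) atTop
      (nhds (∫ x, topV x ∂lawV)) := by
  have h := tendsto_integral_of_tendstoInDistribution tendstoInDistribution_topV
    (fun n => memLp_walkLaw n _) (memLp_topV 2 (by simp)) (C := 37) fun n => by
      -- The constant `37` is `1 + 36`, from `y² ≤ 1 + y⁴`.
      have h1 : ∫ N, (1 + topV (scaledVec n N) ^ 4) ∂(walkLaw n) ≤ 37 := by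
        rw [integral_add (integral_walkFrom _ _ _).1 (integral_walkFrom _ _ _).1]
        simp only [integral_const, probReal_univ, smul_eq_mul, mul_one]
        linarith [integral_pow_four_topV_scaledVec_le n]
      refine (integral_mono (integral_walkFrom _ _ _).1 (integral_walkFrom _ _ _).1
        fun N => ?_).trans h1
      simp only [Function.comp_apply]
      nlinarith [sq_nonneg (topV (scaledVec n N) ^ 2 - 1)]
  refine h.congr fun n => ?_
  simp only [Function.comp_apply, topV_scaledVec]
  rw [integral_div, (integral_walkFrom _ _ _).2]

lemma tendsto_moveStep_maxDiff_sq :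
    Tendsto (fun n : ℕ => moveStep^[3 * n] (fun N => maxDiff (realVec N) ^ 2) 0 / n) atTop
      (nhds (∫ x, topV x ^ 2 ∂lawV)) := by
  have hd := tendstoInDistribution_topV.continuous_comp (g := fun y : ℝ => y ^ 2) (by fun_prop)
  have h4 : MemLp (fun x => topV x ^ 2) 2 lawV := by
    rw [memLp_two_iff_integrable_sq (by fun_prop)]
    have := (memLp_topV 4 (by simp)).integrable_norm_pow (by norm_num)
    refine this.congr (Eventually.of_forall fun x => ?_)
    simp only [Real.norm_eq_abs]
    rw [← pow_mul]
    exact (Even.pow_abs (by decide) _)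
  have h := tendsto_integral_of_tendstoInDistribution hd
    (fun n => memLp_walkLaw n _) h4 (C := 36) fun n => by
      simp only [Function.comp_apply, ← pow_mul]
      exact integral_pow_four_topV_scaledVec_le n
  refine h.congr fun n => ?_
  simp only [Function.comp_apply, topV_scaledVec, div_pow]
  rw [integral_div, (integral_walkFrom _ _ _).2, Real.sq_sqrt n.cast_nonneg]

lemma tendsto_moveStep_exp (u : ℝ) :
    Tendsto (fun n : ℕ => moveStep^[3 * n]
      (fun N => Complex.exp ((u * (maxDiff (realVec N) / √n) : ℝ) * Complex.I)) 0) atTop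
      (nhds (∫ x, Complex.exp ((u * topV x : ℝ) * Complex.I) ∂lawV)) := by
  have h := ProbabilityMeasure.tendsto_iff_tendsto_charFun.1 tendstoInDistribution_topV.tendsto u
  simp only [ProbabilityMeasure.coe_mk, charFun_apply_real] at h
  rw [integral_map (by fun_prop) (by fun_prop)] at h
  simp only [← Complex.ofReal_mul] at h
  refine h.congr fun n => ?_
  rw [integral_map (measurable_of_countable _).aemeasurable (by fun_prop)]
  simp only [Function.comp_apply, topV_scaledVec]
  rw [(integral_walkFrom _ _ _).2]

/-! ### The score of the greedy game -/

section score

variable {ρ ν : Finset Move → PMF Move}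

/-- The choice `δ = √n` balances `3/2 * δ` against `6n / (2δ)`, both of order `√n`. -/
lemma norm_integral_scoreLaw_sub_le {E : Type*} [NormedAddCommGroup E] [NormedSpace ℝ E]
    [CompleteSpace E] (hρ : IsGreedyR ρ) (hν : IsGreedyN ν) {n : ℕ} (hn : 0 < n) {φ : ℝ → E}
    {α β γ : ℝ} (hβ : 0 ≤ β) (hγ : 0 ≤ γ)
    (hφ : ∀ x y, ‖φ x - φ y‖ ≤ α + β * (x - y) ^ 2 + γ * y ^ 2) :
    ‖∫ k : ℤ, φ k ∂(scoreLaw ρ ν n).toMeasure -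
      uStep^[3 * n] (fun x => φ (freeScore x)) (0, 0)‖ ≤ 2 * α + 36 * β * √n + 32 * γ * n := by
  have hn' : (0 : ℝ) < n := by exact_mod_cast hn
  rw [(integral_scoreLaw ρ ν n (fun k : ℤ => φ k)).2]
  refine (norm_gStep_sub_uStep_le hρ hν hβ hγ (Real.sqrt_pos.2 hn') hφ (3 * n) 0 0
    (fun i => by simp) (by simp)).trans (le_of_eq ?_)
  have h0 : sqDiff (realVec 0) = 0 := by simp [sqDiff, realVec]
  have hs : √(n : ℝ) * √n = n := Real.mul_self_sqrt hn'.le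
  have hs0 : 0 < √(n : ℝ) := Real.sqrt_pos.2 hn'
  have e : (0 + 2 * ((3 * n : ℕ) : ℝ)) / (2 * √n) = 3 * √n := by
    push_cast
    rw [div_eq_iff (by positivity)]
    linear_combination (-6 : ℝ) * hs
  rw [h0, e]
  push_cast
  ring

/-- The fourth root of `n`. -/
noncomputable def fourthRoot (n : ℕ) : ℝ := √(√n)

lemma fourthRoot_sq (n : ℕ) : fourthRoot n ^ 2 = √n := Real.sq_sqrt (Real.sqrt_nonneg _)

lemma fourthRoot_pos {n : ℕ} (hn : 0 < n) : 0 < fourthRoot n :=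
  Real.sqrt_pos.2 (Real.sqrt_pos.2 (by exact_mod_cast hn))

lemma tendsto_fourthRoot : Tendsto fourthRoot atTop atTop :=
  Real.tendsto_sqrt_atTop.comp (Real.tendsto_sqrt_atTop.comp tendsto_natCast_atTop_atTop)

/-- Young's inequality at scale `n^(1/4)` replaces the Lipschitz bound by a constant plus a square,
making `α` and `β * √n` both of order `n^(-1/4)`. -/
lemma tendsto_integral_scoreLaw_sub_of_lipschitz {E : Type*} [NormedAddCommGroup E]
    [NormedSpace ℝ E] [CompleteSpace E] (hρ : IsGreedyR ρ) (hν : IsGreedyN ν) {ψ : ℝ → E} {L : ℝ}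
    (hL : 0 ≤ L) (hψ : ∀ x y, ‖ψ x - ψ y‖ ≤ L * |x - y|) :
    Tendsto (fun n : ℕ => ∫ k : ℤ, ψ (k / √n) ∂(scoreLaw ρ ν n).toMeasure -
      uStep^[3 * n] (fun x => ψ (freeScore x / √n)) (0, 0)) atTop (nhds 0) := by
  have h0 : Tendsto (fun n : ℕ => 38 * L / fourthRoot n) atTop (nhds 0) :=
    tendsto_fourthRoot.const_div_atTop _
  refine squeeze_zero_norm' ?_ h0
  filter_upwards [eventually_gt_atTop 0] with n hn
  have hq := fourthRoot_pos hn
  have hs := fourthRoot_sq n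
  have h := norm_integral_scoreLaw_sub_le hρ hν hn (φ := fun x => ψ (x / √n))
    (α := L / fourthRoot n) (β := L / fourthRoot n ^ 3) (γ := 0) (by positivity) le_rfl
    fun x y => by
      refine (hψ _ _).trans ?_
      rw [← sub_div, abs_div, abs_of_nonneg (Real.sqrt_nonneg _), ← hs, zero_mul, add_zero]
      have h1 : |x - y| / fourthRoot n ^ 2 ≤
          1 / fourthRoot n + (x - y) ^ 2 / fourthRoot n ^ 3 := by
        rw [← sq_abs (x - y), ← sub_nonneg]
        have : 1 / fourthRoot n + |x - y| ^ 2 / fourthRoot n ^ 3 - |x - y| / fourthRoot n ^ 2 =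
            (fourthRoot n ^ 2 + |x - y| ^ 2 - |x - y| * fourthRoot n) / fourthRoot n ^ 3 := by
          field_simp
        rw [this]
        refine div_nonneg ?_ (by positivity)
        nlinarith [sq_nonneg (fourthRoot n - |x - y|), sq_nonneg (fourthRoot n),
          sq_nonneg |x - y|]
      calc L * (|x - y| / fourthRoot n ^ 2) ≤
          L * (1 / fourthRoot n + (x - y) ^ 2 / fourthRoot n ^ 3) :=
            mul_le_mul_of_nonneg_left h1 hL
        _ = _ := by ring
  refine h.trans (le_of_eq ?_)
  rw [← hs]
  field_simp
  ring

lemma tendsto_integral_sq_scoreLaw_sub (hρ : IsGreedyR ρ) (hν : IsGreedyN ν) :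
    Tendsto (fun n : ℕ => (∫ k : ℤ, (k : ℝ) ^ 2 ∂(scoreLaw ρ ν n).toMeasure) / n -
      uStep^[3 * n] (fun x => freeScore x ^ 2) (0, 0) / n) atTop (nhds 0) := by
  have h0 : Tendsto (fun n : ℕ => 68 / fourthRoot n + 36 * (1 / fourthRoot n) ^ 2) atTop
      (nhds (0 + 36 * 0 ^ 2)) :=
    (tendsto_fourthRoot.const_div_atTop _).add
      (((tendsto_fourthRoot.const_div_atTop 1).pow 2).const_mul 36)
  norm_num only at h0
  refine squeeze_zero_norm' ?_ h0
  filter_upwards [eventually_gt_atTop 0] with n hn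
  have hn' : (0 : ℝ) < n := by exact_mod_cast hn
  have hq := fourthRoot_pos hn
  have hs := fourthRoot_sq n
  have hs4 : (n : ℝ) = fourthRoot n ^ 4 := by
    rw [show 4 = 2 * 2 by norm_num, pow_mul, hs, Real.sq_sqrt hn'.le]
  -- The cross term `2(x - y)y` is split with weight `n^(1/4)`, so that `β * √n` and `γ * n` are
  -- both of order `n^(3/4)`.
  have h := norm_integral_scoreLaw_sub_le hρ hν hn (φ := fun x : ℝ => x ^ 2)
    (α := 0) (β := 1 + fourthRoot n) (γ := 1 / fourthRoot n) (by positivity) (by positivity)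
    fun x y => by
      rw [Real.norm_eq_abs, zero_add]
      set q := fourthRoot n
      have key : 2 * (|x - y| * |y|) ≤ q * (x - y) ^ 2 + 1 / q * y ^ 2 := by
        rw [← sq_abs (x - y), ← sq_abs y, ← sub_nonneg]
        have : q * |x - y| ^ 2 + 1 / q * |y| ^ 2 - 2 * (|x - y| * |y|) =
            (q * |x - y| - |y|) ^ 2 / q := by
          field_simp
          ring
        rw [this]
        positivity
      have e : x ^ 2 - y ^ 2 = (x - y) ^ 2 + 2 * ((x - y) * y) := by ring
      rw [e]
      refine (abs_add_le _ _).trans ?_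
      rw [abs_mul, abs_mul, abs_two, abs_of_nonneg (sq_nonneg (x - y))]
      linarith
  rw [← sub_div, norm_div, Real.norm_of_nonneg hn'.le, div_le_iff₀ hn']
  refine h.trans (le_of_eq ?_)
  rw [← hs, hs4]
  field_simp
  ring

/-! ### Limits of the moments and of the characteristic function -/

lemma uStep_iterate_freeScore (t : ℕ) :
    uStep^[t] freeScore (0, 0) = moveStep^[t] (fun N => maxDiff (realVec N)) 0 := by
  have h := uStep_iterate_add (fun x : (Move → ℕ) × ℤ => (x.2 : ℝ) * 1)
    (fun x => 1 * maxDiff (realVec x.1)) t (0, 0)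
  rw [uStep_iterate_mul (fun s : ℤ => (s : ℝ)) (fun _ => 1),
    uStep_iterate_mul (fun _ => 1) (fun N => maxDiff (realVec N)), gainStep_iterate_cast,
    gainStep_iterate_const] at h
  simp only [mul_one, one_mul, Int.cast_zero, zero_mul, zero_add] at h
  exact h

/-- The cross term disappears because the free score has mean zero and is independent of the counts.
-/
lemma uStep_iterate_freeScore_sq (t : ℕ) :
    uStep^[t] (fun x => freeScore x ^ 2) (0, 0) =
      2 / 3 * t + moveStep^[t] (fun N => maxDiff (realVec N) ^ 2) 0 := by
  have e : (fun x : (Move → ℕ) × ℤ => freeScore x ^ 2) = fun x =>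
      (x.2 : ℝ) ^ 2 * 1 + (x.2 * (2 * maxDiff (realVec x.1)) + 1 * maxDiff (realVec x.1) ^ 2) := by
    ext x
    unfold freeScore
    ring
  rw [e, uStep_iterate_add, uStep_iterate_add,
    uStep_iterate_mul (fun s : ℤ => (s : ℝ) ^ 2) (fun _ => 1),
    uStep_iterate_mul (fun s : ℤ => (s : ℝ)) (fun N => 2 * maxDiff (realVec N)),
    uStep_iterate_mul (fun _ => 1) (fun N => maxDiff (realVec N) ^ 2), gainStep_iterate_cast,
    gainStep_iterate_const, gainStep_iterate_sq, moveStep_iterate_const]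
  simp

lemma tendsto_mean_scoreLaw (hρ : IsGreedyR ρ) (hν : IsGreedyN ν) :
    Tendsto (fun n : ℕ => (∫ k : ℤ, (k : ℝ) ∂(scoreLaw ρ ν n).toMeasure) / √n) atTop
      (nhds (∫ x, topV x ∂lawV)) := by
  have h := tendsto_integral_scoreLaw_sub_of_lipschitz hρ hν (ψ := fun x : ℝ => x) (L := 1)
    zero_le_one (fun x y => by simp)
  have h2 := h.add tendsto_moveStep_maxDiff
  rw [zero_add] at h2
  refine h2.congr fun n => ?_
  have e : (fun x => freeScore x / √n) = fun x => (√(n : ℝ))⁻¹ • freeScore x := by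
    ext x; rw [smul_eq_mul]; ring
  rw [e, uStep_iterate_smul]
  have := uStep_iterate_freeScore (3 * n)
  change uStep^[3 * n] (fun x => freeScore x) (0, 0) = _ at this
  rw [this, integral_div, smul_eq_mul]
  ring

lemma tendsto_second_moment_scoreLaw (hρ : IsGreedyR ρ) (hν : IsGreedyN ν) :
    Tendsto (fun n : ℕ => (∫ k : ℤ, (k : ℝ) ^ 2 ∂(scoreLaw ρ ν n).toMeasure) / n) atTop
      (nhds (2 + ∫ x, topV x ^ 2 ∂lawV)) := by
  have h := (tendsto_integral_sq_scoreLaw_sub hρ hν).add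
    ((tendsto_const_nhds (x := (2 : ℝ))).add tendsto_moveStep_maxDiff_sq)
  rw [zero_add] at h
  refine h.congr' ?_
  filter_upwards [eventually_gt_atTop 0] with n hn
  have hn' : (n : ℝ) ≠ 0 := by positivity
  rw [uStep_iterate_freeScore_sq]
  push_cast
  field_simp
  ring

lemma norm_exp_mul_I_sub_le (x y : ℝ) :
    ‖Complex.exp (x * Complex.I) - Complex.exp (y * Complex.I)‖ ≤ |x - y| := by
  have e : Complex.exp (x * Complex.I) - Complex.exp (y * Complex.I) =
      Complex.exp (y * Complex.I) * (Complex.exp (Complex.I * ((x - y : ℝ) : ℂ)) - 1) := by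
    rw [mul_sub, ← Complex.exp_add, mul_one]
    congr 2
    push_cast
    ring
  rw [e, norm_mul, Complex.norm_exp_ofReal_mul_I, one_mul]
  exact (Real.norm_exp_I_mul_ofReal_sub_one_le).trans (Real.norm_eq_abs _).le

lemma tendsto_charFun_scoreLaw (hρ : IsGreedyR ρ) (hν : IsGreedyN ν) (u : ℝ) :
    Tendsto (fun n : ℕ => ∫ k : ℤ, Complex.exp ((u * (k / √n) : ℝ) * Complex.I)
        ∂(scoreLaw ρ ν n).toMeasure) atTop
      (nhds (charFun (gaussianReal 0 2) u *
        ∫ x, Complex.exp ((u * topV x : ℝ) * Complex.I) ∂lawV)) := by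
  have h := tendsto_integral_scoreLaw_sub_of_lipschitz hρ hν
    (ψ := fun x : ℝ => Complex.exp ((u * x : ℝ) * Complex.I)) (L := |u|)
    (abs_nonneg u) (fun x y => by
      refine (norm_exp_mul_I_sub_le _ _).trans (le_of_eq ?_)
      rw [← mul_sub, abs_mul])
  -- The squares of these entries sum to `2 * u ^ 2`, whence the limit `N(0, 2)`.
  have hw := tendsto_avg_exp_pow (fun r => u * ![0, 1, -1] r) (by simp [Fin.sum_univ_three])
  have h2 := h.add (hw.mul (tendsto_moveStep_exp u))
  rw [zero_add] at h2
  convert h2 using 2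
  · rename_i n
    have e : (fun x => Complex.exp ((u * (freeScore x / √n) : ℝ) * Complex.I)) = fun x =>
        Complex.exp (((u / √n : ℝ) : ℂ) * x.2 * Complex.I) *
          Complex.exp ((u * (maxDiff (realVec x.1) / √n) : ℝ) * Complex.I) := by
      ext x
      rw [← Complex.exp_add]
      congr 1
      unfold freeScore
      push_cast
      ring
    rw [e, uStep_iterate_mul (fun s : ℤ => Complex.exp (((u / √n : ℝ) : ℂ) * s * Complex.I))
      (fun N => Complex.exp ((u * (maxDiff (realVec N) / √n) : ℝ) * Complex.I)),
      gainStep_iterate_exp]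
    simp only [Int.cast_zero, mul_zero, zero_mul, Complex.exp_zero, mul_one, div_mul_eq_mul_div,
      sub_add_cancel]
  · rw [charFun_gaussianReal]
    congr 2
    simp [Fin.sum_univ_three]

end score

/-! ### The moments of `S*` -/

lemma memLp_Sstar : MemLp Sstar 2 lawWV := by
  have h1 : MemLp (fun ω : ℝ × EuclideanSpace ℝ (Fin 3) => ω.1) 2 lawWV :=
    (memLp_id_gaussianReal 2).comp_fst _
  have h2 : MemLp (fun ω : ℝ × EuclideanSpace ℝ (Fin 3) => topV ω.2) 2 lawWV :=
    (memLp_topV 2 (by simp)).comp_snd _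
  exact h1.add h2

lemma integral_Sstar : ∫ ω, Sstar ω ∂lawWV = ∫ x, topV x ∂lawV := by
  have h1 : MemLp (fun ω : ℝ × EuclideanSpace ℝ (Fin 3) => ω.1) 2 lawWV :=
    (memLp_id_gaussianReal 2).comp_fst _
  have h2 : MemLp (fun ω : ℝ × EuclideanSpace ℝ (Fin 3) => topV ω.2) 2 lawWV :=
    (memLp_topV 2 (by simp)).comp_snd _
  simp only [Sstar_eq]
  rw [integral_add (h1.integrable (by norm_num)) (h2.integrable (by norm_num)),
    integral_fun_fst (f := fun w : ℝ => w), integral_fun_snd (f := topV)]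
  simp [integral_id_gaussianReal]

lemma integral_sq_gaussianReal : ∫ w, w ^ 2 ∂(gaussianReal 0 2) = 2 := by
  have h := variance_id_gaussianReal (μ := 0) (v := 2)
  rw [variance_of_integral_eq_zero (by fun_prop) (by simp [integral_id_gaussianReal])] at h
  simpa using h

lemma integral_Sstar_sq : ∫ ω, Sstar ω ^ 2 ∂lawWV = 2 + ∫ x, topV x ^ 2 ∂lawV := by
  have h1 : MemLp (fun ω : ℝ × EuclideanSpace ℝ (Fin 3) => ω.1) 2 lawWV :=
    (memLp_id_gaussianReal 2).comp_fst _
  have h2 : MemLp (fun ω : ℝ × EuclideanSpace ℝ (Fin 3) => topV ω.2) 2 lawWV :=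
    (memLp_topV 2 (by simp)).comp_snd _
  have h12 : Integrable (fun ω : ℝ × EuclideanSpace ℝ (Fin 3) => ω.1 * topV ω.2) lawWV :=
    h1.integrable_mul h2
  have e (ω) : Sstar ω ^ 2 = ω.1 ^ 2 + (2 * (ω.1 * topV ω.2) + topV ω.2 ^ 2) := by
    rw [Sstar_eq]; ring
  simp only [e]
  have h23 : Integrable (fun ω : ℝ × EuclideanSpace ℝ (Fin 3) =>
      2 * (ω.1 * topV ω.2) + topV ω.2 ^ 2) lawWV := (h12.const_mul 2).add h2.integrable_sq
  rw [integral_add h1.integrable_sq h23,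
    integral_add (h12.const_mul 2) h2.integrable_sq, integral_const_mul,
    integral_prod_mul (fun w : ℝ => w) topV, integral_fun_fst (f := fun w : ℝ => w ^ 2),
    integral_fun_snd (f := fun x => topV x ^ 2), integral_sq_gaussianReal]
  simp [integral_id_gaussianReal]

lemma charFun_map_Sstar (u : ℝ) : charFun (lawWV.map Sstar) u =
    charFun (gaussianReal 0 2) u * ∫ x, Complex.exp ((u * topV x : ℝ) * Complex.I) ∂lawV := by
  have hc : Continuous Sstar := by
    simp only [funext Sstar_eq]
    fun_prop
  rw [charFun_apply_real, integral_map hc.aemeasurable (by fun_prop), charFun_apply_real,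
    ← integral_prod_mul]
  refine integral_congr_ae (Eventually.of_forall fun ω => ?_)
  simp only [Sstar_eq]
  rw [← Complex.exp_add]
  congr 1
  push_cast
  ring

lemma variance_Sstar : Var[Sstar; lawWV] = 4 - (27 - 6 * √3) / (4 * π) := by
  have h3 : √3 * √3 = 3 := Real.mul_self_sqrt (by norm_num)
  have := Real.pi_pos
  rw [variance_eq_sub memLp_Sstar]
  simp only [Pi.pow_apply]
  rw [integral_Sstar_sq, integral_Sstar, integral_topV, integral_topV_sq, div_pow, mul_pow, mul_pow,
    Real.sq_sqrt Real.pi_pos.le, Real.sq_sqrt (by norm_num)]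
  field_simp
  ring

lemma variance_limit_pos : 0 < 4 - (27 - 6 * √3) / (4 * π) := by
  have h : (27 - 6 * √3) / (4 * π) < 4 := by
    rw [div_lt_iff₀ (by positivity)]
    linarith [Real.pi_gt_three, Real.sqrt_nonneg 3]
  linarith

lemma numerical_bounds : |(4 + 3 * √3 / (2 * π)) - (4.82699 : ℝ)| < 0.000005 ∧
    |(4 - (27 - 6 * √3) / (4 * π)) - (2.67840 : ℝ)| < 0.000005 := by
  have hp1 := Real.pi_gt_d20
  have hp2 := Real.pi_lt_d20
  have h1 : (1.73205080 : ℝ) < √3 := Real.lt_sqrt_of_sq_lt (by norm_num)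
  have h2 : √3 < 1.73205081 := by
    rw [Real.sqrt_lt' (by norm_num)]; norm_num
  have a1 : 3 * √3 / (2 * π) < 0.826994 := by
    rw [div_lt_iff₀ (by positivity)]; linarith
  have a2 : 0.826986 < 3 * √3 / (2 * π) := by
    rw [lt_div_iff₀ (by positivity)]; linarith
  have b1 : (27 - 6 * √3) / (4 * π) < 1.321604 := by
    rw [div_lt_iff₀ (by positivity)]; linarith
  have b2 : 1.321596 < (27 - 6 * √3) / (4 * π) := by
    rw [lt_div_iff₀ (by positivity)]; linarith
  constructor <;> rw [abs_lt] <;> constructor <;> linarith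

/-- Convergence in distribution alone does not control variances; the separately proved limits of
the first two moments do. -/
lemma isEquivalent_variance_scoreLaw {ρ ν : Finset Move → PMF Move} (hρ : IsGreedyR ρ)
    (hν : IsGreedyN ν) :
    (fun n : ℕ => Var[fun k : ℤ => (k : ℝ); (scoreLaw ρ ν n).toMeasure])
      ~[atTop] (fun n : ℕ => (4 - (27 - 6 * √3) / (4 * π)) * (n : ℝ)) := by
  have hc := variance_limit_pos
  refine Asymptotics.isEquivalent_of_tendsto_one ?_
  have h := (tendsto_second_moment_scoreLaw hρ hν).sub ((tendsto_mean_scoreLaw hρ hν).pow 2)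
  have hv : 2 + ∫ x, topV x ^ 2 ∂lawV - (∫ x, topV x ∂lawV) ^ 2 =
      4 - (27 - 6 * √3) / (4 * π) := by
    rw [← variance_Sstar, variance_eq_sub memLp_Sstar]
    simp only [Pi.pow_apply]
    rw [integral_Sstar_sq, integral_Sstar]
  rw [hv] at h
  have h1 := h.div_const (4 - (27 - 6 * √3) / (4 * π))
  rw [div_self hc.ne'] at h1
  refine h1.congr' ?_
  filter_upwards [eventually_gt_atTop 0] with n hn
  have hn' : (0 : ℝ) < n := by exact_mod_cast hn
  have hL : MemLp (fun k : ℤ => (k : ℝ)) 2 (scoreLaw ρ ν n).toMeasure :=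
    (memLp_two_iff_integrable_sq (by fun_prop)).2 (integral_scoreLaw ρ ν n _).1
  simp only [Pi.div_apply]
  rw [variance_eq_sub hL, div_pow, Real.sq_sqrt hn'.le]
  simp only [Pi.pow_apply]
  field_simp

end SemiRestrictedRPS

theorem mainTheorem4 (ρ ν : Finset SemiRestrictedRPS.Move → PMF SemiRestrictedRPS.Move)
    (hρ : SemiRestrictedRPS.IsGreedyR ρ) (hν : SemiRestrictedRPS.IsGreedyN ν) :
    -- `S*` is the limit in distribution of `S_n / √n`
    TendstoInDistribution (fun (n : ℕ) (k : ℤ) => (k : ℝ) / √(n : ℝ)) atTop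
      SemiRestrictedRPS.Sstar
      (fun n : ℕ => (SemiRestrictedRPS.scoreLaw ρ ν n).toMeasure) SemiRestrictedRPS.lawWV ∧
    -- second moment and variance of `S*`
    MemLp SemiRestrictedRPS.Sstar 2 SemiRestrictedRPS.lawWV ∧
    ∫ ω, SemiRestrictedRPS.Sstar ω ^ 2 ∂SemiRestrictedRPS.lawWV = 4 + 3 * √3 / (2 * π) ∧
    Var[SemiRestrictedRPS.Sstar; SemiRestrictedRPS.lawWV] = 4 - (27 - 6 * √3) / (4 * π) ∧
    -- the variance of the score
    (fun n : ℕ => Var[fun k : ℤ => (k : ℝ); (SemiRestrictedRPS.scoreLaw ρ ν n).toMeasure])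
      ~[atTop] (fun n : ℕ => (4 - (27 - 6 * √3) / (4 * π)) * (n : ℝ)) ∧
    -- the numerical values
    |(4 + 3 * √3 / (2 * π)) - (4.82699 : ℝ)| < 0.000005 ∧
    |(4 - (27 - 6 * √3) / (4 * π)) - (2.67840 : ℝ)| < 0.000005 := by
  open SemiRestrictedRPS in
  refine ⟨⟨fun n => by fun_prop, memLp_Sstar.aestronglyMeasurable.aemeasurable, ?_⟩, memLp_Sstar,
    ?_, variance_Sstar, isEquivalent_variance_scoreLaw hρ hν, numerical_bounds⟩
  · refine ProbabilityMeasure.tendsto_iff_tendsto_charFun.2 fun u => ?_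
    simp only [ProbabilityMeasure.coe_mk]
    rw [charFun_map_Sstar]
    refine (tendsto_charFun_scoreLaw hρ hν u).congr fun n => ?_
    rw [charFun_apply_real, integral_map (by fun_prop) (by fun_prop)]
    simp only [Complex.ofReal_mul]
  · rw [integral_Sstar_sq, integral_topV_sq]
    ring
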